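/- Let $C=[0,\infty)^2$ and $\dot C=(0,\infty)^2$. For $x,y\in\mathbb R^2$ write $x\le y$ if $x_i\le y_i$ for $i=1,2$; $x<y$ if $x\le y$ and $x\ne y$; $x\ll y$ if $x_i<y_i$ for $i=1,2$; and $x\ll_K y$ if $x_1<y_1$ and $x_2>y_2$. Let $[x,y]=\{z: x\le z\le y\}$. A set is a monotone curve in one of these relations if it is a continuous injective image of a nondegenerate interval and any two distinct points of it are related by that relation. Let $f=(f_1,f_2):C\to\dot C$ be a $C^1$ map (one-sided derivatives on the boundary of $C$) and $T(x)=(x_1f_1(x),x_2f_2(x))$. Assume $f_1(0),f_2(0)>1$, and that there is $r\gg 0$ such that: * for every $x\in C$ the limit set $\omega(x)=\bigcap_{n\ge0}\overline{\{T^m(x):m\ge n\}}$ is nonempty and contained in $[0,r]$; * $0\le T(x)\ll r$ for all $x\in[0,r]$; * for all $x\in[0,r]$ the matrix $M(x)=\big(-\tfrac{x_i}{f_i(x)}\tfrac{\partial f_i}{\partial x_j}(x)\big)_{i,j}$ has spectral radius $\rho(M(x))<1$; * $T$ is type-K competitive on $[0,r]$: $\frac{\partial f_i}{\partial x_i}<0$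 and $\frac{\partial f_i}{\partial x_j}\ge0$ on $[0,r]$ for $i\ne j$. For a fixed point $Q$ of $T$ in $C$ let $W^s(Q)=\{x\in C: T^n(x)\to Q\}$, and let $W^u(Q)$ be the set of $x\in C$ that have a backward orbit $(u_n)_{n\ge0}$ in $C$ ($u_0=x$, $T(u_{n+1})=u_n$) with $u_n\to Q$. Let $T^{-1}$ be the inverse of $T|_{[0,r]}$, and $$\mathcal A=\bigcap_{n\ge0}T^n([0,r]),\quad \mathcal R(0)=\{x: T^{-n}(x)\to0\},\quad \Sigma=\mathcal A\setminus\mathcal R(0).$$ With $\alpha(x)=\bigcap_{n\ge0}\overline{\{T^{-m}(x):m\ge n\}}$ and $C_H$, $C_V$ the closed half axes $\{x\in C:x_2=0\}$, $\{x\in C:x_1=0\}$, let $\Sigma_H=\{x\in\Sigma:\alpha(x)\subset\Sigma\cap C_H\}$, $\Sigma_V=\{x\in\Sigma:\alpha(x)\subset\Sigma\cap C_V\}$ and $\Sigma_0=\Sigma\setminus(\Sigma_H\cup\Sigma_V)$. Then: (a) For $i=1,2$, $T$ has exactly one fixed point $Q_i$ on the positive half $x_i$-axis. It is a saddle (the eigenvalues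 of $DT(Q_i)$ are real, one of modulus $<1$ and one of modulus $>1$), $W^s(Q_i)$ is the positive half $x_i$-axis, and $W^u(Q_i)\setminus\{Q_i\}\subset\dot C$. (b) $T$ has a fixed point $p_0\in\dot C$ such that the following holds. If $p_0$ is the only fixed point in $\dot C$, then it is globally asymptotically stable in $\dot C$ (Lyapunov stable and attracting every point of $\dot C$). Otherwise $T$ has a fixed point $p_1\gg p_0$ such that for every $x\in\dot C$ the sequence $(T^n(x))_n$ converges to a fixed point in $[p_0,p_1]$ and is, from some $n$ on, constant, or strictly monotone (increasing or decreasing) in $\ll_K$, or strictly monotone in $<$. (c) $\Sigma=\Sigma_H\cup\Sigma_0\cup\Sigma_V$ is the global attractor of $T$ on $C\setminus\{0\}$: a nonempty compact subset of $C\setminus\{0\}$ with $T(\Sigma)=\Sigma$ that attracts every compact subset of $C\setminus\{0\}$ uniformly. Moreover $\Sigma_H=W^u(Q_1)\cup\{Q_1\}$ and $\Sigma_V=W^u(Q_2)\cup\{Q_2\}$, and both are monotone curves in $<$. If $p_0$ is the only fixed point in $\dot C$, then $\Sigma_0=\{p_0\}$; otherwise $\Sigma_0$ is a monotone curve in $\ll$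 with endpoints $p_0$ and $p_1$, for the points of (b). If $\frac{\partial f_1}{\partial x_2}>0$ and $\frac{\partial f_2}{\partial x_1}>0$ on $[0,r]$, then $\Sigma_H$ and $\Sigma_V$ are monotone curves in $\ll$. -/

import Mathlib

open Set Filter Topology

noncomputable section

namespace PlanarKolmogorov

/-- The plane, with its coordinatewise order `≤` and the associated `<` (`≤` and `≠`).
`StrongLT x y` is the relation `x ≪ y`, that is, `x i < y i` for both `i`.
The two coordinates are indexed by `0` and `1`. -/
abbrev Plane : Type := Fin 2 → ℝ

/-- The closed nonnegative quadrant `C`. -/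
def quadrant : Set Plane := {x | ∀ i, 0 ≤ x i}

/-- The open quadrant, the interior of `C`. -/
def openQuadrant : Set Plane := {x | ∀ i, 0 < x i}

/-- The closed half axis of `C` in direction `i`; `C_H` for `i = 0` and `C_V` for `i = 1`. -/
def halfAxis (i : Fin 2) : Set Plane := {x | 0 ≤ x i ∧ ∀ j, j ≠ i → x j = 0}

/-- The positive half axis in direction `i`, without the origin. -/
def posHalfAxis (i : Fin 2) : Set Plane := {x | 0 < x i ∧ ∀ j, j ≠ i → x j = 0}

/-- The strong type-K order `x ≪_K y`, for `K = {p | p 0 ≥ 0 and p 1 ≤ 0}`. -/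
def StrongLTK (x y : Plane) : Prop := x 0 < y 0 ∧ y 1 < x 1

/-- The Kolmogorov map `T` with `T_i(x) = x_i f_i(x)`. -/
def kolmogorovMap (f : Plane → Plane) : Plane → Plane := fun x i => x i * f x i

/-- The partial derivative of `f_i` in direction `j` at a point `x` of `C`
(one-sided where `x` is on the boundary). -/
def partialDeriv (f : Plane → Plane) (i j : Fin 2) (x : Plane) : ℝ :=
  fderivWithin ℝ f quadrant x (Pi.single j 1) i

/-- The planar system is type-K competitive on `S`: each species inhibits itself and does not
harm the other one. -/
def TypeKCompetitiveOn (f : Plane → Plane) (S : Set Plane) : Prop :=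
  ∀ x ∈ S, ∀ i, partialDeriv f i i x < 0 ∧ ∀ j, j ≠ i → 0 ≤ partialDeriv f i j x

/-- The matrix `M(x)` with entries `-(x_i / f_i(x)) ∂f_i/∂x_j(x)`. -/
def matM (f : Plane → Plane) (x : Plane) : Matrix (Fin 2) (Fin 2) ℝ :=
  Matrix.of fun i j => -(x i / f x i) * partialDeriv f i j x

/-- The spectral radius of a real matrix: the largest modulus of its complex eigenvalues. -/
def specRadius (A : Matrix (Fin 2) (Fin 2) ℝ) : ENNReal :=
  spectralRadius ℂ (A.map (algebraMap ℝ ℂ))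

/-- The omega limit set of the forward orbit of `x`. -/
def omegaSet (T : Plane → Plane) (x : Plane) : Set Plane :=
  ⋂ n : ℕ, closure {y | ∃ m, n ≤ m ∧ T^[m] x = y}

/-- The alpha limit set of `y` in `X`. When `T` is injective on `X` and maps `X` into itself, the
set `{z ∈ X | T^[m] z = y}` consists of the one point `T⁻ᵐ y`, if that exists. -/
def alphaSet (T : Plane → Plane) (X : Set Plane) (y : Plane) : Set Plane :=
  ⋂ n : ℕ, closure {z | z ∈ X ∧ ∃ m, n ≤ m ∧ T^[m] z = y}

/-- The sequence `u` is a complete backward orbit of `x` inside `X`. -/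
def IsBackwardOrbit (T : Plane → Plane) (X : Set Plane) (x : Plane) (u : ℕ → Plane) : Prop :=
  u 0 = x ∧ ∀ n, u n ∈ X ∧ T (u (n + 1)) = u n

/-- The stable manifold of a fixed point `Q`, in the phase space `C`. -/
def stableManifold (T : Plane → Plane) (Q : Plane) : Set Plane :=
  {x | x ∈ quadrant ∧ Tendsto (fun n => T^[n] x) atTop (𝓝 Q)}

/-- The unstable manifold of a fixed point `Q`, in the phase space `C`. It contains `Q` itself. -/
def unstableManifold (T : Plane → Plane) (Q : Plane) : Set Plane :=
  {x | ∃ u, IsBackwardOrbit T quadrant x u ∧ Tendsto u atTop (𝓝 Q)}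

/-- `Q` is a (hyperbolic) saddle fixed point of the planar map `T` on `C`: one of the two
eigenvalues of `DT(Q)` has modulus below one, the other has modulus above one. -/
def IsSaddle (T : Plane → Plane) (Q : Plane) : Prop :=
  T Q = Q ∧ ∃ L : Plane →L[ℝ] Plane, HasFDerivWithinAt T L quadrant Q ∧
    ∃ a b : ℝ, Module.End.HasEigenvalue (L : Plane →ₗ[ℝ] Plane) a ∧
      Module.End.HasEigenvalue (L : Plane →ₗ[ℝ] Plane) b ∧ |a| < 1 ∧ 1 < |b|

/-- `p` is a globally asymptotically stable fixed point of `T` in `X`: it is Lyapunov stable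
and attracts every point of `X`. -/
def GloballyAsymptoticallyStableIn (T : Plane → Plane) (X : Set Plane) (p : Plane) : Prop :=
  T p = p ∧
  (∀ U ∈ 𝓝 p, ∃ V ∈ 𝓝 p, ∀ x ∈ V ∩ X, ∀ n : ℕ, T^[n] x ∈ U) ∧
  ∀ x ∈ X, Tendsto (fun n => T^[n] x) atTop (𝓝 p)

/-- The sequence `u` is eventually increasing or eventually decreasing for the relation `R`. -/
def EventuallyMonotoneIn (R : Plane → Plane → Prop) (u : ℕ → Plane) : Prop :=
  (∀ᶠ n in atTop, R (u n) (u (n + 1))) ∨ (∀ᶠ n in atTop, R (u (n + 1)) (u n))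

/-- The fundamental attractor `𝒜 = ⋂ Tⁿ([0, r])`. -/
def fundAttractor (T : Plane → Plane) (r : Plane) : Set Plane :=
  ⋂ n : ℕ, T^[n] '' Icc 0 r

/-- The basin of repulsion of the origin: the points `x` with `T⁻ⁿ(x) → 0`, where `T⁻¹` is
the inverse of the restriction of `T` to `[0, r]`. -/
def repulsionBasin (T : Plane → Plane) (r : Plane) : Set Plane :=
  {x | ∃ u, IsBackwardOrbit T (Icc 0 r) x u ∧ Tendsto u atTop (𝓝 0)}

/-- The set `Σ = 𝒜 \ ℛ(0)`. -/
def sigmaSet (T : Plane → Plane) (r : Plane) : Set Plane :=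
  fundAttractor T r \ repulsionBasin T r

/-- The points of `Σ` whose alpha limit set lies in `Σ` and in the half axis in direction `i`:
`Σ_H` for `i = 0` and `Σ_V` for `i = 1`. -/
def sigmaAxis (T : Plane → Plane) (r : Plane) (i : Fin 2) : Set Plane :=
  {x | x ∈ sigmaSet T r ∧ alphaSet T (Icc 0 r) x ⊆ sigmaSet T r ∩ halfAxis i}

/-- The remaining part `Σ_0 = Σ \ (Σ_H ∪ Σ_V)`. -/
def sigmaZero (T : Plane → Plane) (r : Plane) : Set Plane :=
  sigmaSet T r \ (sigmaAxis T r 0 ∪ sigmaAxis T r 1)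

/-- `S` is the global attractor of `T` on `X`: nonempty, compact, contained in `X`, invariant, and
attracting every compact subset of `X` uniformly. -/
def IsGlobalAttractorOn (T : Plane → Plane) (X S : Set Plane) : Prop :=
  S.Nonempty ∧ IsCompact S ∧ S ⊆ X ∧ T '' S = S ∧
    ∀ B, IsCompact B → B ⊆ X → ∀ U, IsOpen U → S ⊆ U →
      ∀ᶠ n in atTop, ∀ x ∈ B, T^[n] x ∈ U

/-- Any two distinct points of `S` are related by `R`. -/
def OrderedBy (R : Plane → Plane → Prop) (S : Set Plane) : Prop :=
  ∀ x ∈ S, ∀ y ∈ S, x ≠ y → R x y ∨ R y x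

/-- `S` is a curve: a continuous injective image of a nondegenerate interval. -/
def IsCurve (S : Set Plane) : Prop :=
  ∃ (I : Set ℝ) (γ : ℝ → Plane), I.OrdConnected ∧ I.Nontrivial ∧
    ContinuousOn γ I ∧ InjOn γ I ∧ γ '' I = S

/-- `S` is a curve that is monotone in the relation `R`. -/
def IsMonotoneCurve (R : Plane → Plane → Prop) (S : Set Plane) : Prop :=
  IsCurve S ∧ OrderedBy R S

/-- `S` is a curve from the point `p` to the point `q` that is monotone in the relation `R`. -/
def IsMonotoneCurveFromTo (R : Plane → Plane → Prop) (p q : Plane) (S : Set Plane) : Prop :=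
  (∃ γ : ℝ → Plane, ContinuousOn γ (Icc 0 1) ∧ InjOn γ (Icc 0 1) ∧ γ '' Icc 0 1 = S ∧
    γ 0 = p ∧ γ 1 = q) ∧ OrderedBy R S

end PlanarKolmogorov

end

open PlanarKolmogorov

namespace PlanarKolmogorov

/-! The map is monotone in two ways at once. Its Jacobian is `diag(f) * (I - M)`; the off-diagonal
entries are nonnegative by type-K competition, and `ρ(M) < 1` makes the diagonal entries and the
determinant positive. Hence on `[0, r]` the map preserves `≤` (`kolmogorovMap_apply_le`), while its
inverse preserves the order of `K`, in which one coordinate grows and the other shrinks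
(`kolmogorovMap_retrotone`). From there on, only the order properties collected in
`IsRetrotoneSystem` drive the dynamics.

Any two points of the plane are comparable in one of the two orders. Applied to consecutive points
of an orbit in `[0, r]`, this makes every forward or backward orbit eventually monotone in each
coordinate, hence convergent to a fixed point (`forward_tendsto`, `backward_tendsto`).

At a fixed point, `f_i = 1` wherever the `i`-th coordinate is positive, and `f_i` strictly decreases
when `x_i` grows and `x_j` does not. So each axis carries one positive fixed point, and distinct
interior fixed points are never `K`-related (`fixed_eq_of_typeK`). The interior ones lie between
`p₀`, the limit of the increasing orbit of the point with coordinates `Q i i`, and `p₁`, the limit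
of the decreasing orbit of `r`.

Points of `Σ` are sorted by their backward limit: an axis fixed point or an interior one. Near a
fixed point with `p_i > 0` the map contracts lengths in direction `i`, so `K`-related backward
orbits with the same limit must agree in that direction (`backward_separation`); this orders each
piece. Moreover `Σ_0`, and each axis piece together with `p₀`, is the set `⋂ Tⁿ[a, b]` for two fixed
points `a ≤ b`. Connectedness makes its projection to a suitable axis fill an interval, and a
compact set projecting injectively onto an interval is a curve. -/

theorem fin_two_cases {i j : Fin 2} (h : i ≠ j) (k : Fin 2) : k = i ∨ k = j := by
  omega

theorem exists_ne_fin_two (i : Fin 2) : ∃ j : Fin 2, i ≠ j := by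
  obtain ⟨j, hj⟩ := exists_ne i
  exact ⟨j, hj.symm⟩

theorem forall_fin_two_iff {i j : Fin 2} (h : i ≠ j) {P : Fin 2 → Prop} :
    (∀ k, P k) ↔ P i ∧ P j :=
  ⟨fun H => ⟨H i, H j⟩, fun H k => by rcases fin_two_cases h k with rfl | rfl; exacts [H.1, H.2]⟩

/-- A nonnegative off-diagonal product makes both eigenvalues real, and the larger one dominates
both diagonal entries. As it is below one, `I - A` has positive diagonal and positive determinant.
-/
theorem det_pos_of_specRadius_lt_one {A : Matrix (Fin 2) (Fin 2) ℝ} (hA : specRadius A < 1)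
    (hoff : 0 ≤ A 0 1 * A 1 0) :
    A 0 0 < 1 ∧ A 1 1 < 1 ∧ A 0 1 * A 1 0 < (1 - A 0 0) * (1 - A 1 1) := by
  set D := Real.sqrt (((A 0 0 - A 1 1) / 2) ^ 2 + A 0 1 * A 1 0) with hD
  have hD0 : 0 ≤ D := Real.sqrt_nonneg _
  have hDsq : D ^ 2 = ((A 0 0 - A 1 1) / 2) ^ 2 + A 0 1 * A 1 0 := Real.sq_sqrt (by positivity)
  have hDabs : |(A 0 0 - A 1 1) / 2| ≤ D := by
    apply abs_le_of_sq_le_sq _ hD0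
    linarith
  set l := (A 0 0 + A 1 1) / 2 + D with hl
  have hroot : (l - A 0 0) * (l - A 1 1) - A 0 1 * A 1 0 = 0 := by
    rw [hl]; linear_combination hDsq
  have hmem : (l : ℂ) ∈ spectrum ℂ (A.map (algebraMap ℝ ℂ)) := by
    rw [spectrum.mem_iff, Matrix.isUnit_iff_isUnit_det, isUnit_iff_ne_zero, not_not,
      Matrix.det_fin_two]
    simp only [Matrix.sub_apply, Matrix.algebraMap_matrix_apply, Matrix.map_apply]
    simp only [Complex.coe_algebraMap, Fin.isValue, if_true, zero_ne_one, if_false, one_ne_zero,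
      Algebra.algebraMap_self, RingHom.id_apply]
    have := congrArg (fun t : ℝ => (t : ℂ)) hroot
    push_cast at this
    linear_combination this
  have hle : (‖(l : ℂ)‖₊ : ENNReal) ≤ specRadius A :=
    le_iSup₂ (f := fun k (_ : k ∈ spectrum ℂ (A.map (algebraMap ℝ ℂ))) => (‖k‖₊ : ENNReal))
      (l : ℂ) hmem
  have hlt : |l| < 1 := by
    have h := lt_of_le_of_lt hle hA
    have h1 : ‖(l : ℂ)‖₊ < 1 := by exact_mod_cast h
    have h2 : ‖(l : ℂ)‖ < 1 := by exact_mod_cast h1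
    simpa using h2
  have hl1 : l < 1 := (abs_lt.1 hlt).2
  obtain ⟨ha, hb⟩ := abs_le.1 hDabs
  refine ⟨by linarith, by linarith, ?_⟩
  -- The eigenvalues are `l` and `l - 2 * D`, so this product is `det (I - A)`.
  have h1 : 0 < (1 - l) * (1 - (l - 2 * D)) := mul_pos (by linarith) (by linarith)
  have h2 : (1 - l) * (1 - (l - 2 * D)) =
      (1 - A 0 0) * (1 - A 1 1) - A 0 1 * A 1 0 := by
    rw [hl]; linear_combination -hDsq
  linarith

theorem growth_eq_one {f : Plane → Plane} {p : Plane} (hfix : kolmogorovMap f p = p) {i : Fin 2}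
    (hi : 0 < p i) : f p i = 1 := by
  have := congrFun hfix i
  simp only [kolmogorovMap] at this
  exact mul_left_cancel₀ hi.ne' (by linarith)

/-! ### Derivatives on the closed quadrant and signs of the Jacobian -/

section Derivatives

variable {f : Plane → Plane} {r : Plane}

theorem Icc_subset_quadrant : Icc 0 r ⊆ quadrant := fun _ hx i => hx.1 i

theorem update_mem_quadrant {x : Plane} (hx : x ∈ quadrant) (k : Fin 2) {s : ℝ} (hs : 0 ≤ s) :
    Function.update x k s ∈ quadrant := by
  intro m
  by_cases h : m = k
  · subst h; simpa using hs
  · simpa [h] using hx m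

theorem update_mem_Icc {x a b : Plane} (hx : x ∈ Icc a b) (k : Fin 2) {s : ℝ}
    (hs : s ∈ Icc (a k) (b k)) : Function.update x k s ∈ Icc a b := by
  refine ⟨fun m => ?_, fun m => ?_⟩ <;> by_cases h : m = k
  · subst h; simpa using hs.1
  · simpa [h] using hx.1 m
  · subst h; simpa using hs.2
  · simpa [h] using hx.2 m

theorem uniqueDiffOn_quadrant : UniqueDiffOn ℝ quadrant := by
  have : quadrant = Set.pi univ fun _ : Fin 2 => Ici (0 : ℝ) := by
    ext x; simp only [quadrant, Set.mem_pi, mem_univ, true_imp_iff, mem_Ici, mem_ofPred_eq]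
  rw [this]
  exact UniqueDiffOn.univ_pi fun _ => uniqueDiffOn_Ici 0

theorem continuousOn_partialDeriv (hf : ContDiffOn ℝ 1 f quadrant) (i j : Fin 2) :
    ContinuousOn (partialDeriv f i j) quadrant := by
  have h := hf.continuousOn_fderivWithin uniqueDiffOn_quadrant le_rfl
  exact (continuous_apply i).comp_continuousOn (h.clm_apply continuousOn_const)

theorem hasDerivAt_apply_update (hf : ContDiffOn ℝ 1 f quadrant) {x : Plane} (hx : x ∈ quadrant)
    (i k : Fin 2) {s : ℝ} (hs : 0 < s) :
    HasDerivAt (fun t => f (Function.update x k t) i)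
      (partialDeriv f i k (Function.update x k s)) s := by
  have hmem := update_mem_quadrant hx k hs.le
  have hd := (hf.differentiableOn one_ne_zero _ hmem).hasFDerivWithinAt
  have hu : HasDerivWithinAt (Function.update x k) (Pi.single k 1) (Ioi 0) s :=
    (hasDerivAt_update x k s).hasDerivWithinAt
  have hc := (hd.comp_hasDerivWithinAt s hu fun t ht => update_mem_quadrant hx k (le_of_lt ht))
  exact hasDerivAt_pi.1 (hc.hasDerivAt (Ioi_mem_nhds hs)) i

theorem continuousOn_apply_update (hf : ContinuousOn f quadrant) {x : Plane} (hx : x ∈ quadrant)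
    (i k : Fin 2) : ContinuousOn (fun t => f (Function.update x k t) i) (Ici 0) := by
  have h1 : ContinuousOn (fun t => f (Function.update x k t)) (Ici 0) :=
    hf.comp (Continuous.continuousOn (by fun_prop)) fun t ht => update_mem_quadrant hx k ht
  exact (continuous_apply i).comp_continuousOn h1

theorem continuousOn_kolmogorovMap (hf : ContinuousOn f quadrant) :
    ContinuousOn (kolmogorovMap f) quadrant :=
  continuousOn_pi.2 fun i => (continuous_apply i).continuousOn.mul
    ((continuous_apply i).comp_continuousOn hf)

theorem hasDerivAt_kolmogorovMap_update (hf : ContDiffOn ℝ 1 f quadrant) {x : Plane}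
    (hx : x ∈ quadrant) (i : Fin 2) {s : ℝ} (hs : 0 < s) :
    HasDerivAt (fun t => kolmogorovMap f (Function.update x i t) i)
      (f (Function.update x i s) i + s * partialDeriv f i i (Function.update x i s)) s := by
  have h := (hasDerivAt_id s).mul (hasDerivAt_apply_update hf hx i i hs)
  simpa [kolmogorovMap, Pi.mul_def] using h

theorem update_update_eq {i j : Fin 2} (h : i ≠ j) (x y : Plane) :
    Function.update (Function.update x i (y i)) j (y j) = y := by
  ext k
  rcases fin_two_cases h k with rfl | rfl
  · simp [h]
  · simp

variable (hf : ContDiffOn ℝ 1 f quadrant) (hpos : ∀ x ∈ quadrant, ∀ i, 0 < f x i)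
  (hrho : ∀ x ∈ Icc 0 r, specRadius (matM f x) < 1) (hK : TypeKCompetitiveOn f (Icc 0 r))

include hpos hrho hK in
/-- The Jacobian matrix of the Kolmogorov map is a `P`-matrix. -/
theorem jacobian_signs {x : Plane} (hx : x ∈ Icc 0 r) {i j : Fin 2} (hij : i ≠ j) :
    0 < f x i + x i * partialDeriv f i i x ∧
      (x i * partialDeriv f i j x) * (x j * partialDeriv f j i x) <
        (f x i + x i * partialDeriv f i i x) * (f x j + x j * partialDeriv f j j x) := by
  have hp : ∀ k, 0 < f x k := hpos x (Icc_subset_quadrant hx)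
  have hx0 : ∀ k, 0 ≤ x k := fun k => hx.1 k
  have key := det_pos_of_specRadius_lt_one (hrho x hx)
  have ho : ∀ k l, l ≠ k → -(x k / f x k) * partialDeriv f k l x ≤ 0 := fun k l h =>
    mul_nonpos_of_nonpos_of_nonneg (neg_nonpos.2 (div_nonneg (hx0 k) (hp k).le))
      ((hK x hx k).2 l h)
  simp only [matM, Matrix.of_apply] at key
  obtain ⟨k0, k1, k2⟩ := key
    (mul_nonneg_of_nonpos_of_nonpos (ho 0 1 (by decide)) (ho 1 0 (by decide)))
  -- Row `k` of the Jacobian is `f x k` times row `k` of `I - M`.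
  have e : ∀ k, (1 - -(x k / f x k) * partialDeriv f k k x) * f x k =
      f x k + x k * partialDeriv f k k x := fun k => by
    have := (hp k).ne'
    field_simp
    ring
  have e0 : ∀ k l, -(x k / f x k) * partialDeriv f k l x * f x k =
      -(x k * partialDeriv f k l x) := fun k l => by
    have := (hp k).ne'
    field_simp
  have hdiag : ∀ k, 0 < f x k + x k * partialDeriv f k k x := by
    intro k
    rw [← e k]
    refine mul_pos ?_ (hp k)
    rcases fin_two_cases (show (0 : Fin 2) ≠ 1 by decide) k with rfl | rfl <;> linarith
  have hdet : (x 0 * partialDeriv f 0 1 x) * (x 1 * partialDeriv f 1 0 x) <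
      (f x 0 + x 0 * partialDeriv f 0 0 x) * (f x 1 + x 1 * partialDeriv f 1 1 x) := by
    rw [← e 0, ← e 1]
    have h := mul_lt_mul_of_pos_right k2 (mul_pos (hp 0) (hp 1))
    calc _ = (-(x 0 * partialDeriv f 0 1 x)) * (-(x 1 * partialDeriv f 1 0 x)) := by ring
      _ = _ := by rw [← e0 0 1, ← e0 1 0]
      _ < _ := by linarith
  refine ⟨hdiag i, ?_⟩
  rcases fin_two_cases (show (0 : Fin 2) ≠ 1 by decide) i with rfl | rfl <;>
    rcases fin_two_cases (show (0 : Fin 2) ≠ 1 by decide) j with rfl | rfl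
  · exact absurd rfl hij
  · exact hdet
  · linarith
  · exact absurd rfl hij

include hf hK in
theorem strictAntiOn_update {x : Plane} (hx : x ∈ Icc 0 r) (i : Fin 2) :
    StrictAntiOn (fun t => f (Function.update x i t) i) (Icc 0 (r i)) := by
  have hxq := Icc_subset_quadrant hx
  refine strictAntiOn_of_deriv_neg (convex_Icc _ _)
    ((continuousOn_apply_update hf.continuousOn hxq i i).mono fun t ht => ht.1) fun s hs => ?_
  rw [interior_Icc] at hs
  rw [(hasDerivAt_apply_update hf hxq i i hs.1).deriv]
  exact (hK _ (update_mem_Icc hx i ⟨hs.1.le, hs.2.le⟩) i).1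

include hf hK in
theorem monotoneOn_update {x : Plane} (hx : x ∈ Icc 0 r) {i j : Fin 2} (hij : i ≠ j) :
    MonotoneOn (fun t => f (Function.update x j t) i) (Icc 0 (r j)) := by
  have hxq := Icc_subset_quadrant hx
  refine monotoneOn_of_deriv_nonneg (convex_Icc _ _)
    ((continuousOn_apply_update hf.continuousOn hxq i j).mono fun t ht => ht.1)
    (fun s hs => ?_) fun s hs => ?_ <;> rw [interior_Icc] at hs
  · exact (hasDerivAt_apply_update hf hxq i j hs.1).differentiableAt.differentiableWithinAt
  · rw [(hasDerivAt_apply_update hf hxq i j hs.1).deriv]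
    exact (hK _ (update_mem_Icc hx j ⟨hs.1.le, hs.2.le⟩) i).2 j hij.symm

include hf in
theorem strictMonoOn_update {x : Plane} (hx : x ∈ Icc 0 r) {i j : Fin 2}
    (h : ∀ x ∈ Icc 0 r, 0 < partialDeriv f i j x) :
    StrictMonoOn (fun t => f (Function.update x j t) i) (Icc 0 (r j)) := by
  have hxq := Icc_subset_quadrant hx
  refine strictMonoOn_of_deriv_pos (convex_Icc _ _)
    ((continuousOn_apply_update hf.continuousOn hxq i j).mono fun t ht => ht.1) fun s hs => ?_
  rw [interior_Icc] at hs
  rw [(hasDerivAt_apply_update hf hxq i j hs.1).deriv]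
  exact h _ (update_mem_Icc hx j ⟨hs.1.le, hs.2.le⟩)

include hf hpos hrho hK in
theorem strictMonoOn_kolmogorovMap_update {x : Plane} (hx : x ∈ Icc 0 r) (i : Fin 2) :
    StrictMonoOn (fun t => kolmogorovMap f (Function.update x i t) i) (Icc 0 (r i)) := by
  have hxq := Icc_subset_quadrant hx
  obtain ⟨j, hij⟩ := exists_ne_fin_two i
  refine strictMonoOn_of_deriv_pos (convex_Icc _ _)
    ((continuousOn_apply_update (continuousOn_kolmogorovMap hf.continuousOn) hxq i i).mono
      fun t ht => ht.1) fun s hs => ?_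
  rw [interior_Icc] at hs
  rw [(hasDerivAt_kolmogorovMap_update hf hxq i hs.1).deriv]
  simpa using (jacobian_signs hpos hrho hK (update_mem_Icc hx i ⟨hs.1.le, hs.2.le⟩) hij).1

theorem exists_jacobian (hf : ContDiffOn ℝ 1 f quadrant) {z : Plane} (hz : z ∈ quadrant) :
    ∃ L : Plane →L[ℝ] Plane, HasFDerivWithinAt (kolmogorovMap f) L quadrant z ∧
      ∀ (v : Plane) (i j : Fin 2), i ≠ j →
        L v i = (f z i + z i * partialDeriv f i i z) * v i + z i * partialDeriv f i j z * v j := by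
  have hd := (hf.differentiableOn one_ne_zero _ hz).hasFDerivWithinAt
  have hi : ∀ i, HasFDerivWithinAt (fun x : Plane => x i * f x i)
      (z i • ((ContinuousLinearMap.proj i).comp (fderivWithin ℝ f quadrant z)) +
        f z i • (ContinuousLinearMap.proj i : Plane →L[ℝ] ℝ)) quadrant z := fun i =>
    (hasFDerivWithinAt_apply i z quadrant).mul (hasFDerivWithinAt_pi'.1 hd i)
  refine ⟨ContinuousLinearMap.pi _, hasFDerivWithinAt_pi.2 hi, fun v i j hij => ?_⟩
  have hv : v = v i • (Pi.single i 1 : Plane) + v j • (Pi.single j 1 : Plane) := by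
    ext k
    rcases fin_two_cases hij k with rfl | rfl
    · simp [hij]
    · simp [hij.symm]
  have hLv : fderivWithin ℝ f quadrant z v i =
      v i * partialDeriv f i i z + v j * partialDeriv f i j z := by
    conv_lhs => rw [hv]
    simp [partialDeriv]
  simp only [ContinuousLinearMap.coe_pi', _root_.add_apply,
    _root_.smul_apply, ContinuousLinearMap.comp_apply, ContinuousLinearMap.proj_apply,
    smul_eq_mul, hLv]
  ring

end Derivatives

/-! ### Moving a point and its image together in the cone of `K` -/

section Derivatives

variable {f : Plane → Plane} {r : Plane} (hf : ContDiffOn ℝ 1 f quadrant)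
  (hpos : ∀ x ∈ quadrant, ∀ i, 0 < f x i)
  (hrho : ∀ x ∈ Icc 0 r, specRadius (matM f x) < 1) (hK : TypeKCompetitiveOn f (Icc 0 r))

include hf hpos hrho hK in
/-- Every point can be moved inside the open cone of the type-K order so that its image moves
inside the same cone. -/
theorem exists_move {z : Plane} (hz : z ∈ Icc 0 r) {i j : Fin 2} (hij : i ≠ j) {b c : ℝ}
    (hb : z i < b) (hc : c < z j) (hc0 : 0 ≤ c) :
    ∃ w ∈ quadrant, z i < w i ∧ w i < b ∧ c < w j ∧ w j < z j ∧
      kolmogorovMap f z i < kolmogorovMap f w i ∧ kolmogorovMap f w j < kolmogorovMap f z j := by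
  have hzq := Icc_subset_quadrant hz
  obtain ⟨L, hL, hLv⟩ := exists_jacobian hf hzq
  obtain ⟨hii, hdet⟩ := jacobian_signs hpos hrho hK hz hij
  obtain ⟨hjj, -⟩ := jacobian_signs hpos hrho hK hz hij.symm
  have hoij : 0 ≤ z i * partialDeriv f i j z := mul_nonneg (hz.1 i) ((hK z hz i).2 j hij.symm)
  have hoji : 0 ≤ z j * partialDeriv f j i z := mul_nonneg (hz.1 j) ((hK z hz j).2 i hij)
  set A := f z i + z i * partialDeriv f i i z
  set D := f z j + z j * partialDeriv f j j z
  set B := z i * partialDeriv f i j z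
  set C := z j * partialDeriv f j i z
  -- This is the adjugate of the Jacobian applied to the vector with entries `1` at `i` and `-1` at
  -- `j`. Its image is therefore the determinant `A * D - B * C > 0` times that vector.
  let v : Plane := Function.update (fun _ => D + B) j (-(A + C))
  have hvi : v i = D + B := by simp [v, hij]
  have hvj : v j = -(A + C) := by simp [v]
  have hLi : 0 < L v i := by rw [hLv v i j hij, hvi, hvj]; nlinarith
  have hLj : L v j < 0 := by rw [hLv v j i hij.symm, hvi, hvj]; nlinarith
  have hline : HasDerivAt (fun t : ℝ => z + t • v) v 0 := by
    simpa using ((hasDerivAt_id (0 : ℝ)).smul_const v).const_add z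
  have hev : ∀ᶠ t in 𝓝[>] (0 : ℝ), z i < (z + t • v) i ∧ (z + t • v) i < b ∧
      c < (z + t • v) j ∧ (z + t • v) j < z j := by
    have hct : ∀ k, Tendsto (fun t : ℝ => (z + t • v) k) (𝓝[>] 0) (𝓝 (z k)) := fun k => by
      have : Continuous fun t : ℝ => (z + t • v) k := by fun_prop
      simpa using (this.tendsto 0).mono_left nhdsWithin_le_nhds
    filter_upwards [(hct i).eventually (eventually_lt_nhds hb),
      (hct j).eventually (eventually_gt_nhds hc), self_mem_nhdsWithin] with t h1 h2 h3
    have h3 : 0 < t := h3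
    refine ⟨?_, h1, h2, ?_⟩
    · simp only [Pi.add_apply, Pi.smul_apply, smul_eq_mul, hvi]
      have := mul_pos h3 (show 0 < D + B by linarith)
      linarith
    · simp only [Pi.add_apply, Pi.smul_apply, smul_eq_mul, hvj]
      have := mul_pos h3 (show 0 < A + C by linarith)
      linarith
  -- At a boundary point the map is differentiable only within the quadrant. The derivative along
  -- the line is first taken over the parameters that stay there, which include all small `t > 0`,
  -- and then passed to `Ioi 0`.
  let s : Set ℝ := {t | z + t • v ∈ quadrant}
  have hs : ∀ᶠ t in 𝓝[>] (0 : ℝ), t ∈ s := hev.mono fun t ht k => by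
    rcases fin_two_cases hij k with rfl | rfl
    · exact (hz.1 _).trans ht.1.le
    · exact hc0.trans ht.2.2.1.le
  have hcomp : HasDerivWithinAt (fun t : ℝ => kolmogorovMap f (z + t • v)) (L v) s 0 :=
    HasFDerivWithinAt.comp_hasDerivWithinAt (l := kolmogorovMap f) (t := quadrant) (0 : ℝ)
      (by simpa using hL) hline.hasDerivWithinAt fun t ht => ht
  have hcomp' : HasDerivWithinAt (fun t : ℝ => kolmogorovMap f (z + t • v)) (L v) (Ioi 0) 0 := by
    have h := hcomp.mono (inter_subset_right (s := Ioi 0))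
    rwa [hasDerivWithinAt_inter' (show s ∈ 𝓝[Ioi 0] (0 : ℝ) from hs)] at h
  have hcomp'' := hasDerivWithinAt_pi.1 hcomp'
  have hslope : ∀ k, Tendsto (fun t : ℝ => t⁻¹ * (kolmogorovMap f (z + t • v) k -
      kolmogorovMap f z k)) (𝓝[>] 0) (𝓝 (L v k)) := fun k => by
    have := (hasDerivWithinAt_iff_tendsto_slope' (by simp)).1 (hcomp'' k)
    refine this.congr fun t => ?_
    simp [slope_def_field, div_eq_inv_mul]
  obtain ⟨t, ⟨h1, h2, h3, h4⟩, hts, h5, h6, h7⟩ := (hev.and (hs.and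
    (((hslope i).eventually (eventually_gt_nhds hLi)).and
      (((hslope j).eventually (eventually_lt_nhds hLj)).and self_mem_nhdsWithin)))).exists
  have h7 : (0 : ℝ) < t := h7
  refine ⟨z + t • v, hts, h1, h2, h3, h4, ?_, ?_⟩
  · have := (pos_iff_pos_of_mul_pos h5).1 (inv_pos.2 h7)
    linarith
  · have := neg_of_mul_neg_right h6 (inv_pos.2 h7).le
    linarith

end Derivatives

/-- The order-theoretic properties of a planar Kolmogorov map that its dynamics depends on. -/
structure IsRetrotoneSystem (f : Plane → Plane) (r : Plane) : Prop where
  continuousOn : ContinuousOn f quadrant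
  pos : ∀ x ∈ quadrant, ∀ i, 0 < f x i
  one_lt : ∀ i, 1 < f 0 i
  r_pos : StrongLT 0 r
  omega_nonempty : ∀ x ∈ quadrant, (omegaSet (kolmogorovMap f) x).Nonempty
  omega_subset : ∀ x ∈ quadrant, omegaSet (kolmogorovMap f) x ⊆ Icc 0 r
  maps : ∀ x ∈ Icc 0 r, StrongLT (kolmogorovMap f x) r
  anti : ∀ x ∈ Icc 0 r, ∀ y ∈ Icc 0 r, ∀ i j, i ≠ j → x i ≤ y i → y j ≤ x j → f y i ≤ f x i
  strictAnti : ∀ x ∈ Icc 0 r, ∀ y ∈ Icc 0 r, ∀ i j, i ≠ j → x i < y i → y j ≤ x j →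
    f y i < f x i
  mono : ∀ x ∈ Icc 0 r, ∀ y ∈ Icc 0 r, x ≤ y → kolmogorovMap f x ≤ kolmogorovMap f y
  strictMono : ∀ x ∈ Icc 0 r, ∀ y ∈ Icc 0 r, x ≤ y → ∀ i, x i < y i →
    kolmogorovMap f x i < kolmogorovMap f y i
  retrotone : ∀ x ∈ Icc 0 r, ∀ y ∈ Icc 0 r, ∀ i j, i ≠ j →
    kolmogorovMap f x i ≤ kolmogorovMap f y i → kolmogorovMap f y j ≤ kolmogorovMap f x j →
      x i ≤ y i ∧ y j ≤ x j
  contracts : ∀ p ∈ Icc 0 r, kolmogorovMap f p = p → ∀ i, 0 < p i → ∃ U ∈ 𝓝 p, ∀ x ∈ U ∩ Icc 0 r,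
    ∀ s, x i ≤ s → Function.update x i s ∈ U ∩ Icc 0 r →
      kolmogorovMap f (Function.update x i s) i - kolmogorovMap f x i ≤ s - x i

/-! ### From derivative signs to order properties -/

section Derivatives

variable {f : Plane → Plane} {r : Plane} (hf : ContDiffOn ℝ 1 f quadrant)
  (hpos : ∀ x ∈ quadrant, ∀ i, 0 < f x i)
  (hrho : ∀ x ∈ Icc 0 r, specRadius (matM f x) < 1) (hK : TypeKCompetitiveOn f (Icc 0 r))

include hf hK in
theorem growth_antitone {x y : Plane} (hx : x ∈ Icc 0 r) (hy : y ∈ Icc 0 r) {i j : Fin 2}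
    (hij : i ≠ j) (hi : x i ≤ y i) (hj : y j ≤ x j) :
    f y i ≤ f x i ∧ (x i < y i → f y i < f x i) := by
  have hyi : y i ∈ Icc 0 (r i) := ⟨hy.1 i, hy.2 i⟩
  have hxi : x i ∈ Icc 0 (r i) := ⟨hx.1 i, hx.2 i⟩
  have hz := update_mem_Icc hx i hyi
  have h1 := strictAntiOn_update hf hK hx i
  have h2 : f y i ≤ f (Function.update x i (y i)) i := by
    have := monotoneOn_update hf hK hz hij ⟨hy.1 j, hy.2 j⟩ ⟨hx.1 j, hx.2 j⟩ hj
    simp only [update_update_eq hij] at this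
    refine this.trans_eq ?_
    rw [show x j = Function.update x i (y i) j by simp [hij.symm], Function.update_eq_self]
  constructor
  · have := h1.antitoneOn hxi hyi hi
    simp only [Function.update_eq_self] at this
    exact h2.trans this
  · intro hlt
    have := h1 hxi hyi hlt
    simp only [Function.update_eq_self] at this
    exact h2.trans_lt this

include hf hpos hrho hK in
-- The path from `x` to `y` first changes coordinate `i`, where `T_i` increases because the diagonal
-- Jacobian entry is positive, and then coordinate `j`, where `f_i` does not decrease.
theorem kolmogorovMap_apply_le {x y : Plane} (hx : x ∈ Icc 0 r) (hy : y ∈ Icc 0 r) (hxy : x ≤ y)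
    (i : Fin 2) : kolmogorovMap f x i ≤ kolmogorovMap f y i ∧
      (x i < y i → kolmogorovMap f x i < kolmogorovMap f y i) := by
  obtain ⟨j, hij⟩ := exists_ne_fin_two i
  have hyi : y i ∈ Icc 0 (r i) := ⟨hy.1 i, hy.2 i⟩
  have hxi : x i ∈ Icc 0 (r i) := ⟨hx.1 i, hx.2 i⟩
  have hz := update_mem_Icc hx i hyi
  have h1 := strictMonoOn_kolmogorovMap_update hf hpos hrho hK hx i
  have h2 : kolmogorovMap f (Function.update x i (y i)) i ≤ kolmogorovMap f y i := by
    have := (growth_antitone hf hK hy hz hij (by simp) (by simpa [hij.symm] using hxy j)).1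
    simp only [kolmogorovMap, Function.update_self]
    exact mul_le_mul_of_nonneg_left this (hy.1 i)
  constructor
  · have := h1.monotoneOn hxi hyi (hxy i)
    simp only [Function.update_eq_self] at this
    exact this.trans h2
  · intro hlt
    have := h1 hxi hyi hlt
    simp only [Function.update_eq_self] at this
    exact this.trans_le h2

include hf hpos hrho hK in
-- Monotonicity for `≤` excludes every failure except that `x` and `y` are strictly related in the
-- reverse `K`-order. In that case a continuation argument in the rectangle between them applies:
-- starting at `y`, a point can be pushed towards `x` with its image moving in the direction of `K`,
-- and it is never stopped by the sides through `x`.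
theorem kolmogorovMap_retrotone {x y : Plane} (hx : x ∈ Icc 0 r) (hy : y ∈ Icc 0 r)
    {i j : Fin 2} (hij : i ≠ j) (hi : kolmogorovMap f x i ≤ kolmogorovMap f y i)
    (hj : kolmogorovMap f y j ≤ kolmogorovMap f x j) : x i ≤ y i ∧ y j ≤ x j := by
  have hle := @kolmogorovMap_apply_le f r hf hpos hrho hK
  by_contra hcon
  rcases le_or_gt (x i) (y i) with h1 | h1
  · have h2 : x j < y j := by
      by_contra h; exact hcon ⟨h1, not_lt.1 h⟩
    have hxy : x ≤ y := (forall_fin_two_iff hij).2 ⟨h1, h2.le⟩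
    exact absurd ((hle hx hy hxy j).2 h2) (not_lt.2 hj)
  rcases le_or_gt (y j) (x j) with h2 | h2
  · have hxy : y ≤ x := (forall_fin_two_iff hij).2 ⟨h1.le, h2⟩
    exact absurd ((hle hy hx hxy i).2 h1) (not_lt.2 hi)
  obtain ⟨w, hwq, w1, w2, w3, w4, w5, w6⟩ := exists_move hf hpos hrho hK hy hij h1 h2 (hx.1 j)
  let R : Set Plane := {z | y i ≤ z i ∧ z i ≤ x i ∧ x j ≤ z j ∧ z j ≤ y j}
  have hRX : R ⊆ Icc 0 r := fun z hz =>
    ⟨(forall_fin_two_iff hij).2 ⟨(hy.1 i).trans hz.1, (hx.1 j).trans hz.2.2.1⟩,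
      (forall_fin_two_iff hij).2 ⟨hz.2.1.trans (hx.2 i), hz.2.2.2.trans (hy.2 j)⟩⟩
  have hRcl : IsClosed R := by
    have hc : ∀ k : Fin 2, Continuous fun z : Plane => z k := continuous_apply
    exact (isClosed_le continuous_const (hc i)).inter ((isClosed_le (hc i) continuous_const).inter
      ((isClosed_le continuous_const (hc j)).inter (isClosed_le (hc j) continuous_const)))
  have hRc : IsCompact R := isCompact_Icc.of_isClosed_subset hRcl hRX
  have hT : ContinuousOn (kolmogorovMap f) R :=
    (continuousOn_kolmogorovMap hf.continuousOn).mono (hRX.trans Icc_subset_quadrant)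
  have hTk : ∀ k, ContinuousOn (fun z => kolmogorovMap f z k) R := continuousOn_pi.1 hT
  -- The image of `w` is strictly beyond that of `y`. Keeping the images beyond that of `w` gives
  -- the strict inequality that keeps the minimizer off the two sides through `x`.
  let S : Set Plane := {z ∈ R | kolmogorovMap f w i ≤ kolmogorovMap f z i ∧
    kolmogorovMap f z j ≤ kolmogorovMap f w j}
  have hScl : IsClosed S := by
    have h1 : IsClosed {z ∈ R | kolmogorovMap f w i ≤ kolmogorovMap f z i} :=
      hRcl.isClosed_le continuousOn_const (hTk i)
    have h2 : IsClosed {z ∈ R | kolmogorovMap f z j ≤ kolmogorovMap f w j} :=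
      hRcl.isClosed_le (hTk j) continuousOn_const
    convert h1.inter h2 using 1
    ext z; simp only [S, mem_ofPred_eq, mem_inter_iff]; tauto
  have hSc : IsCompact S := hRc.of_isClosed_subset hScl fun z hz => hz.1
  have hwS : w ∈ S := ⟨⟨w1.le, w2.le, w3.le, w4.le⟩, le_rfl, le_rfl⟩
  -- The minimizer is a point of `S` pushed as far as possible in the direction of `K`; a further
  -- move contradicts minimality.
  obtain ⟨z, hzS, hmin⟩ := hSc.exists_isMinOn ⟨w, hwS⟩
    (f := fun z => z j - z i) (by fun_prop)
  obtain ⟨hzR, hz1, hz2⟩ := hzS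
  have hzX := hRX hzR
  have hzi : z i < x i := by
    refine lt_of_le_of_ne hzR.2.1 fun h => ?_
    have hxz : x ≤ z := (forall_fin_two_iff hij).2 ⟨h.ge, hzR.2.2.1⟩
    have := (hle hx hzX hxz j).1
    linarith
  have hzj : x j < z j := by
    refine lt_of_le_of_ne hzR.2.2.1 fun h => ?_
    have hzx : z ≤ x := (forall_fin_two_iff hij).2 ⟨hzR.2.1, h.ge⟩
    have := (hle hzX hx hzx i).1
    linarith
  obtain ⟨u, huq, u1, u2, u3, u4, u5, u6⟩ := exists_move hf hpos hrho hK hzX hij hzi hzj (hx.1 j)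
  have huS : u ∈ S := ⟨⟨hzR.1.trans u1.le, u2.le, u3.le, u4.le.trans hzR.2.2.2⟩,
    hz1.trans u5.le, u6.le.trans hz2⟩
  have := hmin huS
  simp only [mem_ofPred_eq] at this
  linarith

include hf hK in
-- At such a point `∂T_i/∂x_i = 1 + p_i ∂f_i/∂x_i < 1`, and by continuity this persists nearby. The
-- mean value argument runs along segments in direction `i`, which stay inside a ball of the sup
-- metric.
theorem exists_nhds_contracts {p : Plane} (hp : p ∈ Icc 0 r) (hpfix : kolmogorovMap f p = p)
    {i : Fin 2} (hpi : 0 < p i) : ∃ U ∈ 𝓝 p, ∀ x ∈ U ∩ Icc 0 r,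
    ∀ s, x i ≤ s → Function.update x i s ∈ U ∩ Icc 0 r →
      kolmogorovMap f (Function.update x i s) i - kolmogorovMap f x i ≤ s - x i := by
  have hpq := Icc_subset_quadrant hp
  have hfp : f p i = 1 := growth_eq_one hpfix hpi
  have hcont : ContinuousOn (fun x : Plane => f x i + x i * partialDeriv f i i x) quadrant :=
    ((continuous_apply i).comp_continuousOn hf.continuousOn).add
      ((continuous_apply i).continuousOn.mul (continuousOn_partialDeriv hf i i))
  have hlt : f p i + p i * partialDeriv f i i p < 1 := by
    rw [hfp]
    have := mul_neg_of_pos_of_neg hpi (hK p hp i).1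
    linarith
  have hev : ∀ᶠ x in 𝓝[quadrant] p, f x i + x i * partialDeriv f i i x < 1 :=
    (hcont p hpq).eventually (eventually_lt_nhds hlt)
  obtain ⟨ε, hε, hball⟩ := Metric.mem_nhdsWithin_iff.1 hev
  refine ⟨Metric.ball p ε, Metric.ball_mem_nhds p hε, fun x hx s hxs hu => ?_⟩
  have hxq := Icc_subset_quadrant hx.2
  have hconv : ∀ t ∈ Icc (x i) s, Function.update x i t ∈ Metric.ball p ε ∩ quadrant := by
    intro t ht
    refine ⟨?_, update_mem_quadrant hxq i ((hxq i).trans ht.1)⟩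
    rw [Metric.mem_ball, dist_pi_lt_iff hε]
    intro k
    have h1 := (dist_pi_lt_iff hε).1 (Metric.mem_ball.1 hx.1) k
    have h2 := (dist_pi_lt_iff hε).1 (Metric.mem_ball.1 hu.1) k
    by_cases hk : k = i
    · subst hk
      simp only [Function.update_self, Real.dist_eq, abs_lt] at h1 h2 ⊢
      constructor <;> linarith [ht.1, ht.2]
    · simpa [hk] using h1
  have hmono : MonotoneOn (fun t => t - kolmogorovMap f (Function.update x i t) i)
      (Icc (x i) s) := by
    refine monotoneOn_of_deriv_nonneg (convex_Icc _ _) ?_ (fun t ht => ?_) fun t ht => ?_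
    · exact continuousOn_id.sub ((continuousOn_apply_update
        (continuousOn_kolmogorovMap hf.continuousOn) hxq i i).mono fun t ht => (hxq i).trans ht.1)
    all_goals
      rw [interior_Icc] at ht
      have hd := (hasDerivAt_id t).sub
        (hasDerivAt_kolmogorovMap_update hf hxq i ((hxq i).trans_lt ht.1))
    · exact hd.differentiableAt.differentiableWithinAt
    · have := hball (hconv t ⟨ht.1.le, ht.2.le⟩)
      simp only [mem_ofPred_eq, Function.update_self] at this
      have e := hd.deriv
      simp only [Pi.sub_def, id_eq] at e
      rw [e]
      linarith
  have := hmono (left_mem_Icc.2 hxs) (right_mem_Icc.2 hxs) hxs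
  simp only [Function.update_eq_self] at this
  linarith

end Derivatives

theorem isRetrotoneSystem {f : Plane → Plane} {r : Plane} (hf : ContDiffOn ℝ 1 f quadrant)
    (hpos : ∀ x ∈ quadrant, ∀ i, 0 < f x i) (h0 : ∀ i, 1 < f 0 i) (hr : StrongLT 0 r)
    (homega : ∀ x ∈ quadrant, (omegaSet (kolmogorovMap f) x).Nonempty ∧
      omegaSet (kolmogorovMap f) x ⊆ Icc 0 r)
    (hmaps : ∀ x ∈ Icc 0 r, StrongLT (kolmogorovMap f x) r)
    (hrho : ∀ x ∈ Icc 0 r, specRadius (matM f x) < 1)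
    (hK : TypeKCompetitiveOn f (Icc 0 r)) : IsRetrotoneSystem f r where
  continuousOn := hf.continuousOn
  pos := hpos
  one_lt := h0
  r_pos := hr
  omega_nonempty x hx := (homega x hx).1
  omega_subset x hx := (homega x hx).2
  maps := hmaps
  anti _ hx _ hy _ _ hij h1 h2 := (growth_antitone hf hK hx hy hij h1 h2).1
  strictAnti _ hx _ hy _ _ hij h1 h2 := (growth_antitone hf hK hx hy hij h1.le h2).2 h1
  mono _ hx _ hy hxy i := (kolmogorovMap_apply_le hf hpos hrho hK hx hy hxy i).1
  strictMono _ hx _ hy hxy i := (kolmogorovMap_apply_le hf hpos hrho hK hx hy hxy i).2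
  retrotone _ hx _ hy _ _ hij := kolmogorovMap_retrotone hf hpos hrho hK hx hy hij
  contracts _ hp hfix _ := exists_nhds_contracts hf hK hp hfix

/-- If the other species is strictly beneficial, then `T_i` is strictly increasing in it. -/
theorem kolmogorovMap_apply_lt_of_partialDeriv_pos {f : Plane → Plane} {r : Plane}
    (hf : ContDiffOn ℝ 1 f quadrant) (h : IsRetrotoneSystem f r) {i j : Fin 2} (hij : i ≠ j)
    (hd : ∀ x ∈ Icc 0 r, 0 < partialDeriv f i j x) {x y : Plane} (hx : x ∈ Icc 0 r)
    (hy : y ∈ Icc 0 r) (hxy : x ≤ y) (hj : x j < y j) (hi : 0 < x i) :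
    kolmogorovMap f x i < kolmogorovMap f y i := by
  have hz := update_mem_Icc hx j ⟨hy.1 j, hy.2 j⟩
  have hzy : Function.update x j (y j) ≤ y :=
    (forall_fin_two_iff hij).2 ⟨by simpa [hij] using hxy i, by simp⟩
  refine lt_of_lt_of_le ?_ (h.mono _ hz _ hy hzy i)
  have := strictMonoOn_update hf hx hd ⟨hx.1 j, hx.2 j⟩ ⟨hy.1 j, hy.2 j⟩ hj
  simp only [Function.update_eq_self] at this
  simp only [kolmogorovMap, Function.update_of_ne hij]
  exact mul_lt_mul_of_pos_left this hi

/-- Since `Q j = 0`, the Jacobian is triangular. The eigenvalue along the axis lies in `(0, 1)`; the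
transversal one is `f Q j`, which exceeds one because the other species only helps: `f Q j ≥ f 0 j >
1`. -/
theorem isSaddle_axis {f : Plane → Plane} {r : Plane} (hf : ContDiffOn ℝ 1 f quadrant)
    (hrho : ∀ x ∈ Icc 0 r, specRadius (matM f x) < 1) (hK : TypeKCompetitiveOn f (Icc 0 r))
    (h : IsRetrotoneSystem f r) {i j : Fin 2} (hij : i ≠ j) {Q : Plane} (hQ : Q ∈ Icc 0 r)
    (hfix : kolmogorovMap f Q = Q) (hi : 0 < Q i) (hj : Q j = 0) :
    IsSaddle (kolmogorovMap f) Q := by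
  have hQq := Icc_subset_quadrant hQ
  obtain ⟨L, hL, hLv⟩ := exists_jacobian hf hQq
  have hfQ : f Q i = 1 := growth_eq_one hfix hi
  have hfj : 1 < f Q j := by
    refine (h.one_lt j).trans_le (h.anti _ hQ _ ⟨le_rfl, fun k => (h.r_pos k).le⟩ j i hij.symm
      hj.le hi.le)
  have ha0 := (jacobian_signs h.pos hrho hK hQ hij).1
  have ha1 : f Q i + Q i * partialDeriv f i i Q < 1 := by
    rw [hfQ]
    have := mul_neg_of_pos_of_neg hi (hK Q hQ i).1
    linarith
  set a := f Q i + Q i * partialDeriv f i i Q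
  set B := Q i * partialDeriv f i j Q
  refine ⟨hfix, L, hL, a, f Q j, ?_, ?_, by rwa [abs_of_pos ha0], hfj.trans_le (le_abs_self _)⟩
  · refine Module.End.hasEigenvalue_of_hasEigenvector (x := Pi.single i 1)
      ⟨Module.End.mem_eigenspace_iff.2 ?_, fun e => by simpa using congrFun e i⟩
    refine funext ((forall_fin_two_iff hij).2 ⟨?_, ?_⟩)
    · change L _ i = _
      rw [hLv _ i j hij]
      simp [hij.symm, a]
    · change L _ j = _
      rw [hLv _ j i hij.symm]
      simp [hij.symm, hj]
  -- The second eigenvector of a triangular matrix; it is nonzero because `a < 1 < f Q j`.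
  · let v : Plane := Function.update (fun _ => B) j (f Q j - a)
    have hvi : v i = B := by simp [v, hij]
    have hvj : v j = f Q j - a := by simp [v]
    refine Module.End.hasEigenvalue_of_hasEigenvector (x := v)
      ⟨Module.End.mem_eigenspace_iff.2 ?_, fun e => ?_⟩
    · refine funext ((forall_fin_two_iff hij).2 ⟨?_, ?_⟩)
      · change L _ i = f Q j * v i
        rw [hLv _ i j hij, hvi, hvj]
        ring
      · change L _ j = f Q j * v j
        rw [hLv _ j i hij.symm, hvi, hvj, hj]
        ring
    · have := congrFun e j
      rw [hvj] at this
      simp only [Pi.zero_apply] at this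
      linarith

/-! ### Backward orbits -/

theorem IsBackwardOrbit.shift {T : Plane → Plane} {X : Set Plane} {x : Plane} {u : ℕ → Plane}
    (hu : IsBackwardOrbit T X x u) (N : ℕ) : IsBackwardOrbit T X (u N) fun n => u (n + N) :=
  ⟨by simp, fun n => ⟨(hu.2 _).1, by
    have := (hu.2 (n + N)).2
    rwa [show n + N + 1 = n + 1 + N by omega] at this⟩⟩

theorem IsBackwardOrbit.iterate_apply {T : Plane → Plane} {X : Set Plane} {x : Plane}
    {u : ℕ → Plane} (hu : IsBackwardOrbit T X x u) (n m : ℕ) : T^[n] (u (n + m)) = u m := by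
  induction n generalizing m with
  | zero => simp
  | succ n ih =>
    rw [Function.iterate_succ_apply', show n + 1 + m = n + (m + 1) by omega, ih]
    exact (hu.2 m).2

theorem IsBackwardOrbit.iterate_eq {T : Plane → Plane} {X : Set Plane} {x : Plane}
    {u : ℕ → Plane} (hu : IsBackwardOrbit T X x u) (n : ℕ) : T^[n] (u n) = x := by
  simpa [hu.1] using hu.iterate_apply n 0

theorem IsBackwardOrbit.cons {T : Plane → Plane} {X : Set Plane} {x : Plane} {u : ℕ → Plane}
    (hu : IsBackwardOrbit T X x u) (hT : T x ∈ X) :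
    IsBackwardOrbit T X (T x) fun n => Nat.casesOn n (T x) u := by
  refine ⟨rfl, fun n => ?_⟩
  cases n with
  | zero => exact ⟨hT, by simp [hu.1]⟩
  | succ n => exact hu.2 n

/-- Every point of a backward orbit is a forward image of points arbitrarily far back, so a tail in
a forward invariant set puts the whole orbit there. -/
theorem IsBackwardOrbit.mem_of_eventually {T : Plane → Plane} {X E : Set Plane} {x : Plane}
    {u : ℕ → Plane} (hu : IsBackwardOrbit T X x u) (hE : MapsTo T E E)
    (hev : ∀ᶠ n in atTop, u n ∈ E) : IsBackwardOrbit T E x u := by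
  obtain ⟨N, hN⟩ := eventually_atTop.1 hev
  refine ⟨hu.1, fun n => ⟨?_, (hu.2 n).2⟩⟩
  rw [← hu.iterate_apply N n]
  exact hE.iterate N (hN _ (by omega))

theorem IsBackwardOrbit.mono {T : Plane → Plane} {X Y : Set Plane} {x : Plane} {u : ℕ → Plane}
    (hu : IsBackwardOrbit T X x u) (hXY : X ⊆ Y) : IsBackwardOrbit T Y x u :=
  ⟨hu.1, fun n => ⟨hXY (hu.2 n).1, (hu.2 n).2⟩⟩

theorem isBackwardOrbit_const {T : Plane → Plane} {X : Set Plane} {p : Plane} (hp : p ∈ X)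
    (hfix : T p = p) : IsBackwardOrbit T X p fun _ => p :=
  ⟨rfl, fun _ => ⟨hp, hfix⟩⟩

/-- A bounded planar sequence with monotone coordinates converges. -/
theorem exists_tendsto_of_monotone_or_antitone {r : Plane} {u : ℕ → Plane}
    (hu : ∀ n, u n ∈ Icc 0 r)
    (hm : ∀ i, (∀ n, u n i ≤ u (n + 1) i) ∨ ∀ n, u (n + 1) i ≤ u n i) :
    ∃ p ∈ Icc 0 r, Tendsto u atTop (𝓝 p) := by
  have : ∀ i, ∃ l, Tendsto (fun n => u n i) atTop (𝓝 l) := by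
    intro i
    rcases hm i with h | h
    · exact ⟨_, tendsto_atTop_ciSup (monotone_nat_of_le_succ h)
        ⟨r i, by rintro _ ⟨n, rfl⟩; exact (hu n).2 i⟩⟩
    · exact ⟨_, tendsto_atTop_ciInf (antitone_nat_of_succ_le h)
        ⟨0, by rintro _ ⟨n, rfl⟩; exact (hu n).1 i⟩⟩
  choose p hp using this
  have hp' : Tendsto u atTop (𝓝 p) := tendsto_pi_nhds.2 hp
  exact ⟨p, isClosed_Icc.mem_of_tendsto hp' (Eventually.of_forall hu), hp'⟩

/-! ### Convergence of orbits, absorption by `[0, r]`, and separation of backward orbits -/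

namespace IsRetrotoneSystem

variable {f : Plane → Plane} {r : Plane} (h : IsRetrotoneSystem f r)

include h

theorem continuousOn_map : ContinuousOn (kolmogorovMap f) quadrant :=
  continuousOn_kolmogorovMap h.continuousOn

theorem mapsTo_quadrant : MapsTo (kolmogorovMap f) quadrant quadrant := fun x hx i =>
  mul_nonneg (hx i) (h.pos x hx i).le

theorem mapsTo_openQuadrant : MapsTo (kolmogorovMap f) openQuadrant openQuadrant := fun x hx i =>
  mul_pos (hx i) (h.pos x (fun k => (hx k).le) i)

theorem mapsTo_Icc : MapsTo (kolmogorovMap f) (Icc 0 r) (Icc 0 r) := fun x hx =>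
  ⟨h.mapsTo_quadrant (Icc_subset_quadrant hx), (h.maps x hx).le⟩

theorem iterate_mem_Icc {x : Plane} (hx : x ∈ Icc 0 r) (n : ℕ) :
    (kolmogorovMap f)^[n] x ∈ Icc 0 r := h.mapsTo_Icc.iterate n hx

theorem continuousOn_iterate (n : ℕ) : ContinuousOn (kolmogorovMap f)^[n] quadrant :=
  h.continuousOn_map.iterate h.mapsTo_quadrant n

theorem iterate_mono {x y : Plane} (hx : x ∈ Icc 0 r) (hy : y ∈ Icc 0 r) (hxy : x ≤ y) (n : ℕ) :
    (kolmogorovMap f)^[n] x ≤ (kolmogorovMap f)^[n] y := by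
  induction n with
  | zero => exact hxy
  | succ n ih =>
    rw [Function.iterate_succ_apply', Function.iterate_succ_apply']
    exact h.mono _ (h.iterate_mem_Icc hx n) _ (h.iterate_mem_Icc hy n) ih

theorem iterate_strongLT {x y : Plane} (hx : x ∈ Icc 0 r) (hy : y ∈ Icc 0 r) (hxy : StrongLT x y)
    (n : ℕ) : StrongLT ((kolmogorovMap f)^[n] x) ((kolmogorovMap f)^[n] y) := by
  induction n with
  | zero => exact hxy
  | succ n ih =>
    rw [Function.iterate_succ_apply', Function.iterate_succ_apply']
    exact fun i => h.strictMono _ (h.iterate_mem_Icc hx n) _ (h.iterate_mem_Icc hy n) ih.le i (ih i)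

theorem injOn : InjOn (kolmogorovMap f) (Icc 0 r) := by
  intro x hx y hy hxy
  have h1 := h.retrotone x hx y hy 0 1 (by decide) (by rw [hxy]) (by rw [hxy])
  have h2 := h.retrotone y hy x hx 0 1 (by decide) (by rw [hxy]) (by rw [hxy])
  exact funext ((forall_fin_two_iff (i := 0) (j := 1) (by decide)).2
    ⟨le_antisymm h1.1 h2.1, le_antisymm h2.2 h1.2⟩)

theorem backward_unique {x : Plane} {u : ℕ → Plane}
    (hu : IsBackwardOrbit (kolmogorovMap f) (Icc 0 r) x u) {n : ℕ} {z : Plane} (hz : z ∈ Icc 0 r)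
    (hzx : (kolmogorovMap f)^[n] z = x) : z = u n :=
  h.injOn.iterate h.mapsTo_Icc n hz (hu.2 n).1 (hzx.trans (hu.iterate_eq n).symm)

theorem backward_eq {x : Plane} {u v : ℕ → Plane}
    (hu : IsBackwardOrbit (kolmogorovMap f) (Icc 0 r) x u)
    (hv : IsBackwardOrbit (kolmogorovMap f) (Icc 0 r) x v) : u = v :=
  funext fun n => h.backward_unique hv (hu.2 n).1 (hu.iterate_eq n)

/-- The backward dynamics preserves the type-K order. -/
theorem backward_retrotone {x y : Plane} {u v : ℕ → Plane}
    (hu : IsBackwardOrbit (kolmogorovMap f) (Icc 0 r) x u)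
    (hv : IsBackwardOrbit (kolmogorovMap f) (Icc 0 r) y v) {i j : Fin 2} (hij : i ≠ j)
    (hi : x i ≤ y i) (hj : y j ≤ x j) (n : ℕ) : u n i ≤ v n i ∧ v n j ≤ u n j := by
  induction n with
  | zero => rw [hu.1, hv.1]; exact ⟨hi, hj⟩
  | succ n ih =>
    refine h.retrotone _ (hu.2 _).1 _ (hv.2 _).1 i j hij ?_ ?_ <;>
      rw [(hu.2 n).2, (hv.2 n).2]
    exacts [ih.1, ih.2]

theorem fixed_of_tendsto {p : Plane} {u v : ℕ → Plane} (hu : ∀ n, u n ∈ Icc 0 r)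
    (hp : p ∈ Icc 0 r) (hup : Tendsto u atTop (𝓝 p)) (hvp : Tendsto v atTop (𝓝 p))
    (huv : ∀ n, kolmogorovMap f (u n) = v n) : kolmogorovMap f p = p := by
  have h1 := (h.continuousOn_map p (Icc_subset_quadrant hp)).tendsto.comp
    (tendsto_nhdsWithin_iff.2 ⟨hup, Eventually.of_forall fun n => Icc_subset_quadrant (hu n)⟩)
  exact tendsto_nhds_unique (h1.congr huv) hvp

theorem forward_fixed {x p : Plane} (hx : x ∈ Icc 0 r) (hp : p ∈ Icc 0 r)
    (hxp : Tendsto (fun n => (kolmogorovMap f)^[n] x) atTop (𝓝 p)) : kolmogorovMap f p = p :=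
  h.fixed_of_tendsto (fun n => h.iterate_mem_Icc hx n) hp hxp
    ((tendsto_add_atTop_iff_nat 1).2 hxp) fun _ => (Function.iterate_succ_apply' _ _ _).symm

/-- Once two consecutive points are `K`-related, the relation persists backward and each coordinate
is monotone. Otherwise consecutive points are always `≤`-comparable, and since the map preserves
`≤`, the direction can change only once. -/
theorem backward_tendsto {x : Plane} {u : ℕ → Plane}
    (hu : IsBackwardOrbit (kolmogorovMap f) (Icc 0 r) x u) :
    ∃ p ∈ Icc 0 r, kolmogorovMap f p = p ∧ Tendsto u atTop (𝓝 p) := by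
  suffices ∃ N, ∀ i, (∀ n, u (n + N) i ≤ u (n + 1 + N) i) ∨
      ∀ n, u (n + 1 + N) i ≤ u (n + N) i by
    obtain ⟨N, hN⟩ := this
    obtain ⟨p, hp, hup⟩ := exists_tendsto_of_monotone_or_antitone
      (u := fun n => u (n + N)) (fun n => (hu.2 _).1) hN
    have hup' := (tendsto_add_atTop_iff_nat N).1 hup
    exact ⟨p, hp, h.fixed_of_tendsto (fun n => (hu.2 (n + 1)).1) hp
      ((tendsto_add_atTop_iff_nat 1).2 hup') hup' fun n => (hu.2 n).2, hup'⟩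
  have shift2 : ∀ N, IsBackwardOrbit (kolmogorovMap f) (Icc 0 r) (u (N + 1))
      fun n => u (n + 1 + N) := fun N => by
    convert hu.shift (N + 1) using 3
    omega
  by_cases hKrel : ∃ N i j, i ≠ j ∧ u N i ≤ u (N + 1) i ∧ u (N + 1) j ≤ u N j
  · obtain ⟨N, i, j, hij, hi, hj⟩ := hKrel
    have := h.backward_retrotone (hu.shift N) (shift2 N) hij hi hj
    exact ⟨N, (forall_fin_two_iff hij).2 ⟨Or.inl fun n => (this n).1, Or.inr fun n => (this n).2⟩⟩
  · push Not at hKrel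
    have hcomp : ∀ n, ¬ u n ≤ u (n + 1) → u (n + 1) ≤ u n := by
      intro n hn
      obtain ⟨i, hi⟩ := not_forall.1 hn
      obtain ⟨j, hij⟩ := exists_ne_fin_two i
      refine (forall_fin_two_iff hij).2 ⟨(not_le.1 hi).le, ?_⟩
      by_contra hj
      exact absurd (hKrel n j i hij.symm (not_le.1 hj).le) (not_lt.2 (not_le.1 hi).le)
    by_cases hall : ∀ n, u n ≤ u (n + 1)
    · exact ⟨0, fun i => Or.inl fun n => hall n i⟩
    · push Not at hall
      obtain ⟨N, hN⟩ := hall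
      have hlater : ∀ n, ¬ u (n + N) ≤ u (n + N + 1) := by
        intro n
        induction n with
        | zero => simpa using hN
        | succ n ih =>
          intro hle
          apply ih
          rw [show n + 1 + N = n + N + 1 by omega] at hle
          have := h.mono _ (hu.2 _).1 _ (hu.2 _).1 hle
          rwa [(hu.2 _).2, (hu.2 _).2] at this
      refine ⟨N, fun i => Or.inr fun n => ?_⟩
      rw [show n + 1 + N = n + N + 1 by omega]
      exact hcomp _ (hlater n) i

/-- Orbits converge, and are eventually constant or monotone. -/
theorem forward_tendsto {x : Plane} (hx : x ∈ Icc 0 r) :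
    (EventuallyConst (fun n => (kolmogorovMap f)^[n] x) atTop ∨
      EventuallyMonotoneIn StrongLTK (fun n => (kolmogorovMap f)^[n] x) ∨
      EventuallyMonotoneIn (· < ·) (fun n => (kolmogorovMap f)^[n] x)) ∧
    ∃ p ∈ Icc 0 r, kolmogorovMap f p = p ∧
      Tendsto (fun n => (kolmogorovMap f)^[n] x) atTop (𝓝 p) := by
  set u : ℕ → Plane := fun n => (kolmogorovMap f)^[n] x with hu
  have huX : ∀ n, u n ∈ Icc 0 r := h.iterate_mem_Icc hx
  have hus : ∀ n, u (n + 1) = kolmogorovMap f (u n) := fun n =>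
    Function.iterate_succ_apply' _ _ _
  have conv : ∀ N, (∀ i, (∀ n, u (n + N) i ≤ u (n + 1 + N) i) ∨
      ∀ n, u (n + 1 + N) i ≤ u (n + N) i) →
      ∃ p ∈ Icc 0 r, kolmogorovMap f p = p ∧ Tendsto u atTop (𝓝 p) := by
    intro N hN
    obtain ⟨p, hp, hup⟩ := exists_tendsto_of_monotone_or_antitone
      (u := fun n => u (n + N)) (fun n => huX _) hN
    have hup' := (tendsto_add_atTop_iff_nat N).1 hup
    exact ⟨p, hp, h.forward_fixed hx hp hup', hup'⟩
  by_cases hconst : ∃ N, u (N + 1) = u N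
  · obtain ⟨N, hN⟩ := hconst
    have hc : ∀ n, u (n + N) = u N := by
      intro n
      induction n with
      | zero => simp
      | succ n ih => rw [show n + 1 + N = n + N + 1 by omega, hus, ih, ← hus, hN]
    refine ⟨Or.inl ?_, conv N fun i => Or.inl fun n => by rw [hc, hc]⟩
    refine eventuallyConst_atTop.2 ⟨N, fun n hn => ?_⟩
    obtain ⟨k, rfl⟩ := Nat.exists_eq_add_of_le' hn
    exact hc k
  push Not at hconst
  by_cases hup : ∃ N, u N ≤ u (N + 1)
  · obtain ⟨N, hN⟩ := hup
    have hc : ∀ n, u (n + N) ≤ u (n + 1 + N) := by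
      intro n
      induction n with
      | zero => simpa [add_comm] using hN
      | succ n ih =>
        have := h.mono _ (huX _) _ (huX _) ih
        rwa [← hus, ← hus, show n + N + 1 = n + 1 + N by omega,
          show n + 1 + N + 1 = n + 1 + 1 + N by omega] at this
    refine ⟨Or.inr (Or.inr (Or.inl ?_)), conv N fun i => Or.inl fun n => hc n i⟩
    refine eventually_atTop.2 ⟨N, fun n hn => ?_⟩
    obtain ⟨k, rfl⟩ := Nat.exists_eq_add_of_le' hn
    refine lt_of_le_of_ne ?_ (hconst _).symm
    have := hc k
    rwa [show k + 1 + N = k + N + 1 by omega] at this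
  by_cases hdn : ∃ N, u (N + 1) ≤ u N
  · obtain ⟨N, hN⟩ := hdn
    have hc : ∀ n, u (n + 1 + N) ≤ u (n + N) := by
      intro n
      induction n with
      | zero => simpa [add_comm] using hN
      | succ n ih =>
        have := h.mono _ (huX _) _ (huX _) ih
        rwa [← hus, ← hus, show n + N + 1 = n + 1 + N by omega,
          show n + 1 + N + 1 = n + 1 + 1 + N by omega] at this
    refine ⟨Or.inr (Or.inr (Or.inr ?_)), conv N fun i => Or.inr fun n => hc n i⟩
    refine eventually_atTop.2 ⟨N, fun n hn => ?_⟩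
    obtain ⟨k, rfl⟩ := Nat.exists_eq_add_of_le' hn
    refine lt_of_le_of_ne ?_ (hconst _)
    have := hc k
    rwa [show k + 1 + N = k + N + 1 by omega] at this
  push Not at hup hdn
  have h01 : (0 : Fin 2) ≠ 1 := by decide
  have hdich : ∀ n, StrongLTK (u n) (u (n + 1)) ∨ StrongLTK (u (n + 1)) (u n) := by
    intro n
    have h1 := fun a b => hup n ((forall_fin_two_iff h01).2 ⟨a, b⟩)
    have h2 := fun a b => hdn n ((forall_fin_two_iff h01).2 ⟨a, b⟩)
    rcases le_total (u n 0) (u (n + 1) 0) with h3 | h3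
    · have h4 : u (n + 1) 1 < u n 1 := not_le.1 (h1 h3)
      exact Or.inl ⟨lt_of_le_of_ne h3 fun e => h2 e.ge h4.le, h4⟩
    · have h4 : u n 1 < u (n + 1) 1 := not_le.1 (h2 h3)
      exact Or.inr ⟨lt_of_le_of_ne h3 fun e => h1 e.ge h4.le, h4⟩
  -- When no consecutive points are `≤`-comparable, retrotonicity carries `≪_K` one step back in
  -- time. The times at which the orbit increases in `≪_K` thus form an initial segment, so the
  -- direction switches at most once.
  have hback : ∀ n, (StrongLTK (u (n + 1)) (u (n + 2)) → StrongLTK (u n) (u (n + 1))) := by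
    intro n hn
    have h1 := h.retrotone (u n) (huX _) (u (n + 1)) (huX _) 0 1 h01
      (by rw [← hus, ← hus]; exact hn.1.le) (by rw [← hus, ← hus]; exact hn.2.le)
    rcases hdich n with h2 | h2
    · exact h2
    · exact absurd h2.1 (not_lt.2 h1.1)
  by_cases hall : ∀ n, StrongLTK (u n) (u (n + 1))
  · refine ⟨Or.inr (Or.inl (Or.inl (Eventually.of_forall hall))), conv 0 ?_⟩
    exact (forall_fin_two_iff h01).2 ⟨Or.inl fun n => (hall n).1.le, Or.inr fun n => (hall n).2.le⟩
  · push Not at hall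
    obtain ⟨N, hN⟩ := hall
    have hc : ∀ n, ¬ StrongLTK (u (n + N)) (u (n + 1 + N)) := by
      intro n
      induction n with
      | zero => simpa [add_comm] using hN
      | succ n ih =>
        intro hlt
        apply ih
        have := hback (n + N)
        rw [show n + N + 1 = n + 1 + N by omega, show n + N + 2 = n + 1 + 1 + N by omega] at this
        exact this hlt
    have hc' : ∀ n, StrongLTK (u (n + 1 + N)) (u (n + N)) := fun n => by
      have h1 := hc n
      have h2 := hdich (n + N)
      rw [show n + N + 1 = n + 1 + N by omega] at h2
      exact h2.resolve_left h1
    refine ⟨Or.inr (Or.inl (Or.inr ?_)), conv N ?_⟩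
    · refine eventually_atTop.2 ⟨N, fun n hn => ?_⟩
      obtain ⟨k, rfl⟩ := Nat.exists_eq_add_of_le' hn
      have := hc' k
      rwa [show k + 1 + N = k + N + 1 by omega] at this
    · exact (forall_fin_two_iff h01).2
        ⟨Or.inr fun n => (hc' n).1.le, Or.inl fun n => (hc' n).2.le⟩

/-- Some omega limit point `q` lies in `[0, r]` and `T q ≪ r`. One step after a visit near `q` the
orbit is strictly below `r`; this is an open condition on the starting point, and `[0, r]` is
forward invariant. -/
theorem eventually_nhdsWithin_iterate_mem {x : Plane} (hx : x ∈ quadrant) :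
    ∃ N, ∀ᶠ y in 𝓝[quadrant] x, ∀ n, N ≤ n → (kolmogorovMap f)^[n] y ∈ Icc 0 r := by
  obtain ⟨q, hq⟩ := h.omega_nonempty x hx
  have hqX := h.omega_subset x hx hq
  have hopen : ∀ z : Plane, StrongLT z r → ∀ᶠ y in 𝓝 z, StrongLT y r := fun z hz =>
    eventually_all.2 fun i => (continuous_apply i).tendsto z |>.eventually (eventually_lt_nhds (hz i))
  have h1 : ∀ᶠ y in 𝓝[quadrant] q, StrongLT (kolmogorovMap f y) r :=
    (h.continuousOn_map q (Icc_subset_quadrant hqX)).eventually (hopen _ (h.maps q hqX))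
  obtain ⟨V, hV, hVsub⟩ := mem_nhdsWithin_iff_exists_mem_nhds_inter.1 h1
  have hcl : q ∈ closure {y | ∃ m, 0 ≤ m ∧ (kolmogorovMap f)^[m] x = y} := mem_iInter.1 hq 0
  obtain ⟨_, hyV, m, -, rfl⟩ := mem_closure_iff_nhds.1 hcl V hV
  have hm : StrongLT ((kolmogorovMap f)^[m + 1] x) r := by
    rw [Function.iterate_succ_apply']
    exact hVsub ⟨hyV, h.mapsTo_quadrant.iterate m hx⟩
  refine ⟨m + 1, ?_⟩
  filter_upwards [(h.continuousOn_iterate (m + 1) x hx).eventually (hopen _ hm),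
    self_mem_nhdsWithin] with y hy hyq n hn
  obtain ⟨k, rfl⟩ := Nat.exists_eq_add_of_le' hn
  rw [Function.iterate_add_apply]
  exact h.iterate_mem_Icc ⟨h.mapsTo_quadrant.iterate _ hyq, hy.le⟩ k

theorem exists_iterate_mem {x : Plane} (hx : x ∈ quadrant) :
    ∃ N, (kolmogorovMap f)^[N] x ∈ Icc 0 r := by
  obtain ⟨N, hN⟩ := h.eventually_nhdsWithin_iterate_mem hx
  exact ⟨N, mem_of_mem_nhdsWithin hx hN N le_rfl⟩

theorem exists_iterate_mem_of_isCompact {B : Set Plane} (hB : IsCompact B) (hBq : B ⊆ quadrant) :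
    ∃ N, ∀ x ∈ B, (kolmogorovMap f)^[N] x ∈ Icc 0 r := by
  -- Quantifying over all `n ≥ N` lets the entry times of two sets be replaced by their maximum.
  suffices ∃ N, ∀ x ∈ B, ∀ n, N ≤ n → (kolmogorovMap f)^[n] x ∈ Icc 0 r by
    obtain ⟨N, hN⟩ := this
    exact ⟨N, fun x hx => hN x hx N le_rfl⟩
  refine hB.induction_on (p := fun S => ∃ N, ∀ x ∈ S, ∀ n, N ≤ n →
    (kolmogorovMap f)^[n] x ∈ Icc 0 r) ⟨0, by simp⟩ ?_ ?_ ?_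
  · rintro s t hst ⟨N, hN⟩
    exact ⟨N, fun x hx => hN x (hst hx)⟩
  · rintro s t ⟨N, hN⟩ ⟨M, hM⟩
    refine ⟨max N M, fun x hx n hn => ?_⟩
    rcases hx with hx | hx
    · exact hN x hx n (le_of_max_le_left hn)
    · exact hM x hx n (le_of_max_le_right hn)
  · intro x hx
    obtain ⟨N, hN⟩ := h.eventually_nhdsWithin_iterate_mem (hBq hx)
    exact ⟨_, nhdsWithin_mono x hBq hN, N, fun y hy => hy⟩

theorem fixed_mem_Icc {p : Plane} (hp : p ∈ quadrant) (hfix : kolmogorovMap f p = p) :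
    p ∈ Icc 0 r := by
  obtain ⟨N, hN⟩ := h.exists_iterate_mem hp
  rwa [Function.iterate_fixed hfix] at hN

/-- Two backward orbits that are related by the type-K order and approach the same fixed point
in direction `i` agree in that direction. -/
theorem backward_separation {x y p : Plane} {u v : ℕ → Plane}
    (hu : IsBackwardOrbit (kolmogorovMap f) (Icc 0 r) x u)
    (hv : IsBackwardOrbit (kolmogorovMap f) (Icc 0 r) y v) {i j : Fin 2} (hij : i ≠ j)
    (hi : x i ≤ y i) (hj : y j ≤ x j) (hp : p ∈ Icc 0 r) (hfix : kolmogorovMap f p = p)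
    (hpi : 0 < p i) (hui : Tendsto (fun n => u n i) atTop (𝓝 (p i)))
    (hvi : Tendsto (fun n => v n i) atTop (𝓝 (p i)))
    (huj : Tendsto (fun n => u n j) atTop (𝓝 (p j))) : x i = y i := by
  have hret := h.backward_retrotone hu hv hij hi hj
  obtain ⟨U, hU, hcontr⟩ := h.contracts p hp hfix i hpi
  -- The corner `w n` differs from `u n` only in direction `i`, where the contraction applies, and
  -- it dominates `v n`. Hence the gap `v n i - u n i` cannot shrink as `n` grows, yet it tends to
  -- zero.
  let w : ℕ → Plane := fun n => Function.update (u n) i (v n i)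
  have hwX : ∀ n, w n ∈ Icc 0 r := fun n =>
    update_mem_Icc (hu.2 n).1 i ⟨(hv.2 n).1.1 i, (hv.2 n).1.2 i⟩
  have hup : Tendsto u atTop (𝓝 p) :=
    tendsto_pi_nhds.2 ((forall_fin_two_iff hij).2 ⟨hui, huj⟩)
  have hwp : Tendsto w atTop (𝓝 p) :=
    tendsto_pi_nhds.2 ((forall_fin_two_iff hij).2
      ⟨by simpa [w] using hvi, by simpa [w, hij.symm] using huj⟩)
  have hstep : ∀ᶠ n in atTop, v n i - u n i ≤ v (n + 1) i - u (n + 1) i := by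
    filter_upwards [((tendsto_add_atTop_iff_nat 1).2 hup).eventually_mem hU,
      ((tendsto_add_atTop_iff_nat 1).2 hwp).eventually_mem hU] with n h1 h2
    have h3 := hcontr (u (n + 1)) ⟨h1, (hu.2 _).1⟩ (v (n + 1) i) (hret (n + 1)).1 ⟨h2, hwX _⟩
    have h4 : v (n + 1) ≤ w (n + 1) :=
      (forall_fin_two_iff hij).2 ⟨by simp [w], by simpa [w, hij.symm] using (hret (n + 1)).2⟩
    have h5 := h.mono _ (hv.2 _).1 _ (hwX _) h4 i
    rw [(hu.2 n).2] at h3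
    rw [(hv.2 n).2] at h5
    simp only [w] at h5
    linarith
  obtain ⟨N, hN⟩ := eventually_atTop.1 hstep
  have hmono : Monotone fun n => v (n + N) i - u (n + N) i :=
    monotone_nat_of_le_succ fun n => by
      have := hN (n + N) (by omega)
      rwa [show n + N + 1 = n + 1 + N by omega] at this
  have hlim : Tendsto (fun n => v (n + N) i - u (n + N) i) atTop (𝓝 0) := by
    simpa using (tendsto_add_atTop_iff_nat N).2 (hvi.sub hui)
  have hzero : v N i ≤ u N i := by
    have := hmono.ge_of_tendsto hlim 0
    simp only [zero_add] at this
    linarith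
  have hle : v N ≤ u N := (forall_fin_two_iff hij).2 ⟨hzero, (hret N).2⟩
  have := h.iterate_mono (hv.2 N).1 (hu.2 N).1 hle N i
  rw [hu.iterate_eq, hv.iterate_eq] at this
  exact le_antisymm hi this

end IsRetrotoneSystem

/-- `Q i` is a fixed point on the positive half axis in direction `i`. -/
structure IsAxisFamily (f : Plane → Plane) (r : Plane) (Q : Fin 2 → Plane) : Prop where
  mem : ∀ i, Q i ∈ Icc 0 r
  pos : ∀ i, 0 < Q i i
  zero : ∀ i j, i ≠ j → Q i j = 0
  fixed : ∀ i, kolmogorovMap f (Q i) = Q i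

/-- `p₀` and `p₁` are the least and the greatest fixed point in the open quadrant, obtained as
monotone limits. -/
structure IsExtremalPair (f : Plane → Plane) (r : Plane) (Q : Fin 2 → Plane) (p₀ p₁ : Plane) :
    Prop where
  mem₀ : p₀ ∈ Icc 0 r
  mem₁ : p₁ ∈ Icc 0 r
  fixed₀ : kolmogorovMap f p₀ = p₀
  fixed₁ : kolmogorovMap f p₁ = p₁
  axis_le : ∀ i, Q i i ≤ p₀ i
  lower : ∀ a ∈ openQuadrant, (∀ i, a i ≤ Q i i) →
    Tendsto (fun n => (kolmogorovMap f)^[n] a) atTop (𝓝 p₀)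
  upper : Tendsto (fun n => (kolmogorovMap f)^[n] r) atTop (𝓝 p₁)

/-- The set of points of `E` whose backward orbit stays in `E`, if `T` is injective on `E`. -/
def core (T : Plane → Plane) (E : Set Plane) : Set Plane := ⋂ n : ℕ, T^[n] '' E

/-! ### Axis fixed points, extremal interior fixed points, and convergence in the open quadrant -/

namespace IsRetrotoneSystem

variable {f : Plane → Plane} {r : Plane} (h : IsRetrotoneSystem f r)

include h

theorem r_mem : r ∈ Icc 0 r := ⟨h.r_pos.le, le_rfl⟩

theorem zero_mem : (0 : Plane) ∈ Icc 0 r := ⟨le_rfl, h.r_pos.le⟩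

theorem tendsto_of_le_map {x : Plane} (hx : x ∈ Icc 0 r) (hle : x ≤ kolmogorovMap f x) :
    ∃ p ∈ Icc 0 r, kolmogorovMap f p = p ∧ x ≤ p ∧
      Tendsto (fun n => (kolmogorovMap f)^[n] x) atTop (𝓝 p) := by
  have hmono : ∀ n, (kolmogorovMap f)^[n] x ≤ (kolmogorovMap f)^[n + 1] x := fun n => by
    rw [Function.iterate_succ_apply]
    exact h.iterate_mono hx (h.mapsTo_Icc hx) hle n
  obtain ⟨p, hp, hxp⟩ := exists_tendsto_of_monotone_or_antitone (h.iterate_mem_Icc hx)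
    fun i => Or.inl fun n => hmono n i
  exact ⟨p, hp, h.forward_fixed hx hp hxp, (monotone_nat_of_le_succ hmono).ge_of_tendsto hxp 0, hxp⟩

theorem tendsto_of_map_le {x : Plane} (hx : x ∈ Icc 0 r) (hle : kolmogorovMap f x ≤ x) :
    ∃ p ∈ Icc 0 r, kolmogorovMap f p = p ∧
      Tendsto (fun n => (kolmogorovMap f)^[n] x) atTop (𝓝 p) := by
  have hmono : ∀ n, (kolmogorovMap f)^[n + 1] x ≤ (kolmogorovMap f)^[n] x := fun n => by
    rw [Function.iterate_succ_apply]
    exact h.iterate_mono (h.mapsTo_Icc hx) hx hle n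
  obtain ⟨p, hp, hxp⟩ := exists_tendsto_of_monotone_or_antitone (h.iterate_mem_Icc hx)
    fun i => Or.inr fun n => hmono n i
  exact ⟨p, hp, h.forward_fixed hx hp hxp, hxp⟩

/-- Intermediate value theorem: `f_i` exceeds one at the origin, and it is at most one at the end of
the axis segment because `T` maps that point below `r`. -/
theorem exists_axis_fixed (i : Fin 2) : ∃ s ∈ Icc 0 (r i), 0 < s ∧
    f (Pi.single i s) i = 1 := by
  have hmaps : ∀ s ∈ Icc 0 (r i), (Pi.single i s : Plane) ∈ Icc 0 r := fun s hs =>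
    update_mem_Icc h.zero_mem i hs
  have hc : ContinuousOn (fun s => f (Pi.single i s) i) (Icc 0 (r i)) :=
    (continuousOn_apply_update h.continuousOn (x := 0) (fun k => le_rfl) i i).mono
      fun s hs => hs.1
  have hri : 0 < r i := h.r_pos i
  have hend : f (Pi.single i (r i)) i ≤ 1 := by
    have := h.maps _ (hmaps (r i) ⟨hri.le, le_rfl⟩) i
    simp only [kolmogorovMap, Pi.single_eq_same] at this
    nlinarith
  obtain ⟨s, hs, hs1⟩ := intermediate_value_Icc' hri.le hc
    (show (1 : ℝ) ∈ Icc _ _ from ⟨hend, by simpa using (h.one_lt i).le⟩)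
  refine ⟨s, hs, lt_of_le_of_ne hs.1 fun e => ?_, hs1⟩
  subst e
  have := h.one_lt i
  simp only [Pi.single_zero] at hs1
  linarith

theorem exists_axisFamily : ∃ Q, IsAxisFamily f r Q := by
  choose s hs hs0 hs1 using h.exists_axis_fixed
  refine ⟨fun i => Pi.single i (s i), fun i => update_mem_Icc h.zero_mem i (hs i), by simpa using hs0,
    fun i j hij => by simp [hij.symm], fun i => ?_⟩
  obtain ⟨j, hij⟩ := exists_ne_fin_two i
  exact funext ((forall_fin_two_iff hij).2
    ⟨by simp [kolmogorovMap, hs1], by simp [kolmogorovMap, hij.symm]⟩)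

variable {Q : Fin 2 → Plane} (hQ : IsAxisFamily f r Q)

include hQ

/-- At `Q i` species `i` has growth rate one with no help from the other species; fewer of its own
kind and any amount of the other cannot lower that rate. -/
theorem one_le_growth {x : Plane} (hx : x ∈ Icc 0 r) {i : Fin 2} (hi : x i ≤ Q i i) :
    1 ≤ f x i := by
  obtain ⟨j, hij⟩ := exists_ne_fin_two i
  rw [← growth_eq_one (hQ.fixed i) (hQ.pos i)]
  exact h.anti _ hx _ (hQ.mem i) i j hij hi (by rw [hQ.zero i j hij]; exact hx.1 j)

theorem one_lt_growth {x : Plane} (hx : x ∈ Icc 0 r) {i : Fin 2} (hi : x i < Q i i) :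
    1 < f x i := by
  obtain ⟨j, hij⟩ := exists_ne_fin_two i
  rw [← growth_eq_one (hQ.fixed i) (hQ.pos i)]
  exact h.strictAnti _ hx _ (hQ.mem i) i j hij hi (by rw [hQ.zero i j hij]; exact hx.1 j)

theorem growth_lt_one {x : Plane} (hx : x ∈ Icc 0 r) {i j : Fin 2} (hij : i ≠ j) (hj : x j = 0)
    (hi : Q i i < x i) : f x i < 1 := by
  rw [← growth_eq_one (hQ.fixed i) (hQ.pos i)]
  exact h.strictAnti _ (hQ.mem i) _ hx i j hij hi (by rw [hQ.zero i j hij, hj])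

theorem axis_le_of_fixed {p : Plane} (hp : p ∈ Icc 0 r) (hfix : kolmogorovMap f p = p)
    {i : Fin 2} (hi : 0 < p i) : Q i i ≤ p i := by
  by_contra hlt
  have := h.one_lt_growth hQ hp (not_le.1 hlt)
  rw [growth_eq_one hfix hi] at this
  exact lt_irrefl _ this

theorem eq_of_fixed_axis {p : Plane} (hp : p ∈ Icc 0 r) (hfix : kolmogorovMap f p = p)
    {i j : Fin 2} (hij : i ≠ j) (hi : 0 < p i) (hj : p j = 0) : p = Q i := by
  refine funext ((forall_fin_two_iff hij).2 ⟨?_, by rw [hj, hQ.zero i j hij]⟩)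
  refine le_antisymm ?_ (h.axis_le_of_fixed hQ hp hfix hi)
  by_contra hlt
  have := h.growth_lt_one hQ hp hij hj (not_le.1 hlt)
  rw [growth_eq_one hfix hi] at this
  exact lt_irrefl _ this

theorem fixed_cases {p : Plane} (hp : p ∈ Icc 0 r) (hfix : kolmogorovMap f p = p) :
    p = 0 ∨ (∃ i, p = Q i) ∨ p ∈ openQuadrant := by
  have h01 : (0 : Fin 2) ≠ 1 := by decide
  rcases (hp.1 0).eq_or_lt with h0 | h0 <;> rcases (hp.1 1).eq_or_lt with h1 | h1
  · exact Or.inl (funext ((forall_fin_two_iff h01).2 ⟨h0.symm, h1.symm⟩))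
  · exact Or.inr (Or.inl ⟨1, h.eq_of_fixed_axis hQ hp hfix h01.symm h1 h0.symm⟩)
  · exact Or.inr (Or.inl ⟨0, h.eq_of_fixed_axis hQ hp hfix h01 h0 h1.symm⟩)
  · exact Or.inr (Or.inr ((forall_fin_two_iff h01).2 ⟨h0, h1⟩))

theorem tendsto_axis {x : Plane} {i : Fin 2} (hx : x ∈ posHalfAxis i) :
    Tendsto (fun n => (kolmogorovMap f)^[n] x) atTop (𝓝 (Q i)) := by
  obtain ⟨j, hij⟩ := exists_ne_fin_two i
  have hxq : x ∈ quadrant := (forall_fin_two_iff hij).2 ⟨hx.1.le, (hx.2 j hij.symm).ge⟩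
  have haxis : ∀ n, 0 < (kolmogorovMap f)^[n] x i ∧ (kolmogorovMap f)^[n] x j = 0 := by
    intro n
    induction n with
    | zero => exact ⟨hx.1, hx.2 j hij.symm⟩
    | succ n ih =>
      rw [Function.iterate_succ_apply']
      exact ⟨mul_pos ih.1 (h.pos _ (h.mapsTo_quadrant.iterate n hxq) i),
        by simp only [kolmogorovMap]; rw [ih.2, zero_mul]⟩
  obtain ⟨N, hN⟩ := h.exists_iterate_mem hxq
  set y := (kolmogorovMap f)^[N] x with hy
  have hyaxis : ∀ n, 0 < (kolmogorovMap f)^[n] y i ∧ (kolmogorovMap f)^[n] y j = 0 := fun n => by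
    rw [hy, ← Function.iterate_add_apply]; exact haxis _
  suffices ∃ p ∈ Icc 0 r, kolmogorovMap f p = p ∧ 0 < p i ∧
      Tendsto (fun n => (kolmogorovMap f)^[n] y) atTop (𝓝 p) by
    obtain ⟨p, hp, hfix, hpi, hyp⟩ := this
    have hpj : p j = 0 := tendsto_nhds_unique (tendsto_pi_nhds.1 hyp j)
      (tendsto_const_nhds.congr fun n => (hyaxis n).2.symm)
    rw [← h.eq_of_fixed_axis hQ hp hfix hij hpi hpj]
    refine (tendsto_add_atTop_iff_nat N).1 (hyp.congr fun n => ?_)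
    rw [hy, ← Function.iterate_add_apply]
  have hy0 := hyaxis 0
  simp only [Function.iterate_zero, id_eq] at hy0
  -- On the axis the orbit is monotone: increasing from below `Q i`, decreasing from above while
  -- staying above `Q i`. Either way its limit is nonzero.
  rcases le_total (y i) (Q i i) with hle | hle
  · obtain ⟨p, hp, hfix, hyp, hlim⟩ := h.tendsto_of_le_map hN ((forall_fin_two_iff hij).2
      ⟨by simpa [kolmogorovMap] using le_mul_of_one_le_right hy0.1.le (h.one_le_growth hQ hN hle),
        by simp [kolmogorovMap, hy0.2]⟩)
    exact ⟨p, hp, hfix, hy0.1.trans_le (hyp i), hlim⟩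
  · have hfy : f y i ≤ 1 := by
      rw [← growth_eq_one (hQ.fixed i) (hQ.pos i)]
      exact h.anti _ (hQ.mem i) _ hN i j hij hle (by rw [hQ.zero i j hij, hy0.2])
    obtain ⟨p, hp, hfix, hlim⟩ := h.tendsto_of_map_le hN ((forall_fin_two_iff hij).2
      ⟨by simpa [kolmogorovMap] using mul_le_of_le_one_right hy0.1.le hfy,
        by simp [kolmogorovMap, hy0.2]⟩)
    refine ⟨p, hp, hfix, (hQ.pos i).trans_le (ge_of_tendsto (tendsto_pi_nhds.1 hlim i)
      (Eventually.of_forall fun n => ?_)), hlim⟩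
    have := h.iterate_mono (hQ.mem i) hN ((forall_fin_two_iff hij).2
      ⟨hle, by rw [hQ.zero i j hij, hy0.2]⟩) n i
    rwa [Function.iterate_fixed (hQ.fixed i)] at this

/-- Positive points `a` below the corner with coordinates `Q i i` satisfy `a ≤ T a`, so their orbits
increase to a positive fixed point. Every positive fixed point dominates the corner, hence also the
limit `p₀` of its orbit; therefore all these orbits share the limit `p₀`. -/
theorem exists_extremalPair : ∃ p₀ p₁, IsExtremalPair f r Q p₀ p₁ := by
  have hsub : ∀ a ∈ openQuadrant, (∀ i, a i ≤ Q i i) → a ∈ Icc 0 r ∧ a ≤ kolmogorovMap f a := by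
    intro a ha haq
    have haX : a ∈ Icc 0 r := ⟨fun i => (ha i).le, fun i => (haq i).trans ((hQ.mem i).2 i)⟩
    exact ⟨haX, fun i => le_mul_of_one_le_right (ha i).le (h.one_le_growth hQ haX (haq i))⟩
  have hqo : (fun i => Q i i) ∈ openQuadrant := hQ.pos
  obtain ⟨hqX, hqT⟩ := hsub _ hqo fun i => le_rfl
  obtain ⟨p₀, h1, h2, h3, h4⟩ := h.tendsto_of_le_map hqX hqT
  obtain ⟨p₁, g1, g2, g3⟩ := h.tendsto_of_map_le h.r_mem (h.maps r h.r_mem).le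
  refine ⟨p₀, p₁, h1, g1, h2, g2, h3, fun a ha haq => ?_, g3⟩
  obtain ⟨haX, haT⟩ := hsub a ha haq
  obtain ⟨p, k1, k2, k3, k4⟩ := h.tendsto_of_le_map haX haT
  have hpp : p₀ = p := by
    refine le_antisymm (le_of_tendsto h4 (Eventually.of_forall fun n => ?_))
      (le_of_tendsto_of_tendsto' k4 h4 fun n => h.iterate_mono haX hqX haq n)
    have := h.iterate_mono hqX k1 (fun i => h.axis_le_of_fixed hQ k1 k2 ((ha i).trans_le (k3 i))) n
    rwa [Function.iterate_fixed k2] at this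
  rwa [hpp]

omit hQ in
/-- Fixed points in the open quadrant are not related by the type-K order. -/
theorem fixed_eq_of_typeK {p p' : Plane} (hp : p ∈ Icc 0 r) (hfix : kolmogorovMap f p = p)
    (hpo : p ∈ openQuadrant) (hp' : p' ∈ Icc 0 r) (hfix' : kolmogorovMap f p' = p')
    (hpo' : p' ∈ openQuadrant) {i j : Fin 2} (hij : i ≠ j) (hi : p i ≤ p' i) (hj : p' j ≤ p j) :
    p = p' := by
  refine funext ((forall_fin_two_iff hij).2 ⟨?_, ?_⟩)
  · refine hi.eq_or_lt.resolve_right fun hlt => ?_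
    have := h.strictAnti _ hp _ hp' i j hij hlt hj
    rw [growth_eq_one hfix (hpo i), growth_eq_one hfix' (hpo' i)] at this
    exact lt_irrefl _ this
  · refine (hj.eq_or_lt.resolve_right fun hlt => ?_).symm
    have := h.strictAnti _ hp' _ hp j i hij.symm hlt hi
    rw [growth_eq_one hfix (hpo j), growth_eq_one hfix' (hpo' j)] at this
    exact lt_irrefl _ this

omit hQ in
-- Here `x = Tⁿ (u n) ≤ Tⁿ r` for all `n`.
theorem backward_le {p₁ x : Plane}
    (hp₁ : Tendsto (fun n => (kolmogorovMap f)^[n] r) atTop (𝓝 p₁)) {u : ℕ → Plane}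
    (hu : IsBackwardOrbit (kolmogorovMap f) (Icc 0 r) x u) : x ≤ p₁ :=
  ge_of_tendsto hp₁ (Eventually.of_forall fun n => by
    have := h.iterate_mono (hu.2 n).1 h.r_mem (hu.2 n).1.2 n
    rwa [hu.iterate_eq] at this)

omit h hQ in
theorem _root_.PlanarKolmogorov.IsExtremalPair.open₀ {p₀ p₁ : Plane} (hQ : IsAxisFamily f r Q)
    (hp : IsExtremalPair f r Q p₀ p₁) : p₀ ∈ openQuadrant :=
  fun i => (hQ.pos i).trans_le (hp.axis_le i)

variable {p₀ p₁ : Plane} (hp : IsExtremalPair f r Q p₀ p₁)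

include hp

theorem least_le_of_fixed {p : Plane} (hpX : p ∈ Icc 0 r) (hfix : kolmogorovMap f p = p)
    (hpo : p ∈ openQuadrant) : p₀ ≤ p := by
  have hqX : (fun i => Q i i) ∈ Icc 0 r :=
    ⟨fun i => (hQ.pos i).le, fun i => (hQ.mem i).2 i⟩
  refine le_of_tendsto (hp.lower _ hQ.pos fun i => le_rfl) (Eventually.of_forall fun n => ?_)
  have := h.iterate_mono hqX hpX (fun i => h.axis_le_of_fixed hQ hpX hfix (hpo i)) n
  rwa [Function.iterate_fixed hfix] at this

omit hQ in
theorem le_greatest_of_fixed {p : Plane} (hpX : p ∈ Icc 0 r) (hfix : kolmogorovMap f p = p) :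
    p ≤ p₁ :=
  h.backward_le hp.upper (isBackwardOrbit_const hpX hfix)

omit hQ in
theorem least_le_greatest : p₀ ≤ p₁ := h.le_greatest_of_fixed hp hp.mem₀ hp.fixed₀

theorem open₁ : p₁ ∈ openQuadrant := fun i =>
  (hp.open₀ hQ i).trans_le (h.least_le_greatest hp i)

theorem forward_mem_Icc {x p : Plane} (hx : x ∈ Icc 0 r) (hxo : x ∈ openQuadrant)
    (hlim : Tendsto (fun n => (kolmogorovMap f)^[n] x) atTop (𝓝 p)) : p ∈ Icc p₀ p₁ := by
  -- A positive point below both `x` and the corner of the `Q i i`: the orbit of `x` is squeezed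
  -- between those of `a` and `r`.
  let a : Plane := fun i => min (x i) (Q i i)
  have hax : a ≤ x := fun i => min_le_left _ _
  have hao : a ∈ openQuadrant := fun i => lt_min (hxo i) (hQ.pos i)
  have haX : a ∈ Icc 0 r := ⟨fun i => (hao i).le, hax.trans hx.2⟩
  exact ⟨le_of_tendsto_of_tendsto' (hp.lower a hao fun i => min_le_right _ _) hlim
      fun n => h.iterate_mono haX hx hax n,
    le_of_tendsto_of_tendsto' hlim hp.upper fun n => h.iterate_mono hx h.r_mem hx.2 n⟩

theorem strongLT_of_ne (hne : p₀ ≠ p₁) : StrongLT p₀ p₁ := by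
  have hle := h.least_le_greatest hp
  intro i
  obtain ⟨j, hij⟩ := exists_ne_fin_two i
  refine lt_of_le_of_ne (hle i) fun e => hne (Eq.symm ?_)
  exact h.fixed_eq_of_typeK hp.mem₁ hp.fixed₁ (h.open₁ hQ hp) hp.mem₀ hp.fixed₀ (hp.open₀ hQ) hij
    e.ge (hle j)

/-- The increasing orbit of a low point and the decreasing orbit of `r` meet at the same limit. The
order intervals between them are forward invariant and shrink to that point. -/
theorem globallyAsymptoticallyStable (heq : p₁ = p₀) :
    GloballyAsymptoticallyStableIn (kolmogorovMap f) openQuadrant p₀ := by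
  refine ⟨hp.fixed₀, fun U hU => ?_, fun x hx => ?_⟩
  -- Halving gives `a ≪ p₀` even if `Q i i = p₀ i`, so the order intervals are neighbourhoods of
  -- `p₀`.
  · let a : Plane := fun i => Q i i / 2
    have hao : a ∈ openQuadrant := fun i => half_pos (hQ.pos i)
    have haq : ∀ i, a i < Q i i := fun i => half_lt_self (hQ.pos i)
    have hap : StrongLT a p₀ := fun i => (haq i).trans_le (hp.axis_le i)
    have haX : a ∈ Icc 0 r := ⟨fun i => (hao i).le, hap.le.trans hp.mem₀.2⟩
    have hpr : StrongLT p₀ r := by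
      have := h.maps _ hp.mem₀
      rwa [hp.fixed₀] at this
    have hup := hp.upper
    rw [heq] at hup
    have hsm := (hp.lower a hao fun i => (haq i).le).Icc hup
    obtain ⟨m, hm⟩ := (hsm.eventually (eventually_smallSets_subset.2 hU)).exists
    have hlow : ∀ n, a ≤ (kolmogorovMap f)^[n] a := by
      intro n
      induction n with
      | zero => exact le_rfl
      | succ n ih =>
        refine (show a ≤ kolmogorovMap f a from fun i => le_mul_of_one_le_right (hao i).le
          (h.one_le_growth hQ haX (haq i).le)).trans ?_
        rw [Function.iterate_succ_apply']
        exact h.mono _ haX _ (h.iterate_mem_Icc haX n) ih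
    refine ⟨Icc ((kolmogorovMap f)^[m] a) ((kolmogorovMap f)^[m] r), ?_, fun x hx n => hm ?_⟩
    · refine pi_Icc_mem_nhds (fun i => ?_) fun i => ?_
      · have := h.iterate_strongLT haX hp.mem₀ hap m i
        rwa [Function.iterate_fixed hp.fixed₀] at this
      · have := h.iterate_strongLT hp.mem₀ h.r_mem hpr m i
        rwa [Function.iterate_fixed hp.fixed₀] at this
    · have hmX := h.iterate_mem_Icc haX m
      have hmR := h.iterate_mem_Icc h.r_mem m
      have hxX : x ∈ Icc 0 r := ⟨hmX.1.trans hx.1.1, hx.1.2.trans hmR.2⟩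
      constructor
      · refine le_trans ?_ (h.iterate_mono hmX hxX hx.1.1 n)
        rw [← Function.iterate_add_apply, add_comm, Function.iterate_add_apply]
        exact h.iterate_mono haX (h.iterate_mem_Icc haX n) (hlow n) m
      · refine (h.iterate_mono hxX hmR hx.1.2 n).trans ?_
        rw [← Function.iterate_add_apply, add_comm, Function.iterate_add_apply]
        exact h.iterate_mono (h.iterate_mem_Icc h.r_mem n) h.r_mem
          (h.iterate_mem_Icc h.r_mem n).2 m
  · obtain ⟨N, hN⟩ := h.exists_iterate_mem fun i => (hx i).le
    obtain ⟨-, p, hpX, hfix, hlim⟩ := h.forward_tendsto hN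
    have hmem := h.forward_mem_Icc hQ hp hN (h.mapsTo_openQuadrant.iterate N hx) hlim
    rw [heq] at hmem
    rw [le_antisymm hmem.1 hmem.2]
    refine (tendsto_add_atTop_iff_nat N).1 (hlim.congr fun n => ?_)
    rw [← Function.iterate_add_apply]

theorem forward_description {x : Plane} (hx : x ∈ openQuadrant) :
    (EventuallyConst (fun n => (kolmogorovMap f)^[n] x) atTop ∨
      EventuallyMonotoneIn StrongLTK (fun n => (kolmogorovMap f)^[n] x) ∨
      EventuallyMonotoneIn (· < ·) (fun n => (kolmogorovMap f)^[n] x)) ∧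
    ∃ p ∈ Icc p₀ p₁, kolmogorovMap f p = p ∧
      Tendsto (fun n => (kolmogorovMap f)^[n] x) atTop (𝓝 p) := by
  obtain ⟨N, hN⟩ := h.exists_iterate_mem fun i => (hx i).le
  obtain ⟨hev, p, hpX, hfix, hlim⟩ := h.forward_tendsto hN
  have e : ∀ n, (kolmogorovMap f)^[n] ((kolmogorovMap f)^[N] x) = (kolmogorovMap f)^[n + N] x :=
    fun n => (Function.iterate_add_apply _ _ _ _).symm
  refine ⟨?_, p, h.forward_mem_Icc hQ hp hN (h.mapsTo_openQuadrant.iterate N hx) hlim, hfix,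
    (tendsto_add_atTop_iff_nat N).1 (hlim.congr e)⟩
  have hshift : ∀ R : Plane → Plane → Prop,
      EventuallyMonotoneIn R (fun n => (kolmogorovMap f)^[n] ((kolmogorovMap f)^[N] x)) →
      EventuallyMonotoneIn R (fun n => (kolmogorovMap f)^[n] x) := by
    have key : ∀ P : ℕ → Prop, (∀ᶠ n in atTop, P (n + N)) → ∀ᶠ n in atTop, P n := by
      intro P hP
      rwa [← map_add_atTop_eq_nat N, eventually_map]
    rintro R (hR | hR)
    · refine Or.inl (key _ (hR.mono fun n hn => ?_))
      beta_reduce at hn ⊢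
      rwa [e, e, show n + 1 + N = n + N + 1 by omega] at hn
    · refine Or.inr (key _ (hR.mono fun n hn => ?_))
      beta_reduce at hn ⊢
      rwa [e, e, show n + 1 + N = n + N + 1 by omega] at hn
  rcases hev with hev | hev | hev
  · left
    obtain ⟨M, hM⟩ := eventuallyConst_atTop.1 hev
    refine eventuallyConst_atTop.2 ⟨M + N, fun n hn => ?_⟩
    obtain ⟨k, rfl⟩ := Nat.exists_eq_add_of_le' hn
    have := hM (k + M) (by omega)
    rwa [e, e, add_assoc] at this
  · exact Or.inr (Or.inl (hshift _ hev))
  · exact Or.inr (Or.inr (hshift _ hev))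

end IsRetrotoneSystem

/-- A compact set on which the coordinate `k` is injective is a curve parametrized by it. -/
theorem exists_continuousOn_section {S : Set Plane} (hS : IsCompact S) {k : Fin 2}
    (hinj : InjOn (fun x : Plane => x k) S) {a b : ℝ} (him : Icc a b ⊆ (fun x : Plane => x k) '' S) :
    ∃ γ : ℝ → Plane, ContinuousOn γ (Icc a b) ∧ ∀ s ∈ Icc a b, γ s ∈ S ∧ γ s k = s := by
  have him' : ∀ s ∈ Icc a b, ∃ x : Plane, x ∈ S ∧ x k = s := him
  choose! γ hγ using him'
  -- The preimage of a closed set `t` under the inverse of the projection is the projection of the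
  -- compact set `S ∩ t`.
  refine ⟨γ, continuousOn_iff_isClosed.2 fun t ht => ⟨(fun x : Plane => x k) '' (S ∩ t),
    ((hS.inter_right ht).image (continuous_apply k)).isClosed, ?_⟩, hγ⟩
  ext s
  constructor
  · rintro ⟨h1, h2⟩
    exact ⟨⟨γ s, ⟨(hγ s h2).1, h1⟩, (hγ s h2).2⟩, h2⟩
  · rintro ⟨⟨x, ⟨hxS, hxt⟩, hxs⟩, h2⟩
    have : x = γ s := hinj hxS (hγ s h2).1 (hxs.trans (hγ s h2).2.symm)
    exact ⟨by rwa [mem_preimage, ← this], h2⟩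

theorem image_iterate_antitone {T : Plane → Plane} {E : Set Plane} (hE : MapsTo T E E) :
    Antitone fun n => T^[n] '' E :=
  antitone_nat_of_succ_le fun n => by
    rintro _ ⟨x, hx, rfl⟩
    exact ⟨T x, hE hx, (Function.iterate_succ_apply _ _ _).symm⟩

/-! ### Cores, the pieces of `Σ` by backward limits, and the invariant manifolds of `Q i` -/

namespace IsRetrotoneSystem

variable {f : Plane → Plane} {r : Plane} (h : IsRetrotoneSystem f r)

include h

theorem mem_core_iff {E : Set Plane} (hEX : E ⊆ Icc 0 r)
    (hE : MapsTo (kolmogorovMap f) E E) {x : Plane} :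
    x ∈ core (kolmogorovMap f) E ↔ ∃ u, IsBackwardOrbit (kolmogorovMap f) E x u := by
  constructor
  · intro hx
    choose u hu using fun n => mem_iInter.1 hx n
    refine ⟨u, (hu 0).2, fun n => ⟨(hu n).1, ?_⟩⟩
    refine h.injOn.iterate h.mapsTo_Icc n (hEX (hE (hu _).1)) (hEX (hu n).1) ?_
    rw [← Function.iterate_succ_apply, (hu _).2, (hu n).2]
  · rintro ⟨u, hu⟩
    exact mem_iInter.2 fun n => ⟨u n, (hu.2 n).1, hu.iterate_eq n⟩

theorem isCompact_image_iterate {E : Set Plane} (hEX : E ⊆ Icc 0 r) (hEc : IsCompact E) (n : ℕ) :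
    IsCompact ((kolmogorovMap f)^[n] '' E) :=
  hEc.image_of_continuousOn ((h.continuousOn_iterate n).mono (hEX.trans Icc_subset_quadrant))

theorem isCompact_core {E : Set Plane} (hEX : E ⊆ Icc 0 r) (hEc : IsCompact E) :
    IsCompact (core (kolmogorovMap f) E) :=
  (h.isCompact_image_iterate hEX hEc 0).of_isClosed_subset
    (isClosed_iInter fun n => (h.isCompact_image_iterate hEX hEc n).isClosed) (iInter_subset _ 0)

/-- The core of an order interval between two fixed points projects onto full intervals. -/
theorem Icc_subset_image_core {a b : Plane} (ha : a ∈ Icc 0 r) (hb : b ∈ Icc 0 r) (hab : a ≤ b)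
    (hfa : kolmogorovMap f a = a) (hfb : kolmogorovMap f b = b) (k : Fin 2) :
    Icc (a k) (b k) ⊆ (fun x : Plane => x k) '' core (kolmogorovMap f) (Icc a b) := by
  intro s hs
  have hEX : Icc a b ⊆ Icc 0 r := Icc_subset_Icc ha.1 hb.2
  have hE : MapsTo (kolmogorovMap f) (Icc a b) (Icc a b) := fun x hx =>
    ⟨hfa.ge.trans (h.mono _ ha _ (hEX hx) hx.1), (h.mono _ (hEX hx) _ hb hx.2).trans hfb.le⟩
  have hcl : IsClosed {x : Plane | x k = s} := isClosed_eq (continuous_apply k) continuous_const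
  have hcpt := fun n => (h.isCompact_image_iterate hEX isCompact_Icc n).inter_right hcl
  obtain ⟨x, hx⟩ := IsCompact.nonempty_iInter_of_sequence_nonempty_isCompact_isClosed
    (fun n => (kolmogorovMap f)^[n] '' Icc a b ∩ {x : Plane | x k = s})
    (fun n => inter_subset_inter_left _ (image_iterate_antitone hE n.le_succ))
    (fun n => by
      -- Each iterated image of the order interval is connected and contains the fixed points `a`
      -- and `b`, so it meets every intermediate level set. These intersections are compact and
      -- nested.
      have hconn : IsPreconnected ((kolmogorovMap f)^[n] '' Icc a b) :=
        (convex_Icc a b).isPreconnected.image _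
          ((h.continuousOn_iterate n).mono (hEX.trans Icc_subset_quadrant))
      obtain ⟨x, hx, hxs⟩ := hconn.intermediate_value
        ⟨a, ⟨le_rfl, hab⟩, Function.iterate_fixed hfa n⟩
        ⟨b, ⟨hab, le_rfl⟩, Function.iterate_fixed hfb n⟩
        (continuous_apply k).continuousOn hs
      exact ⟨x, hx, hxs⟩)
    (hcpt 0) fun n => (hcpt n).isClosed
  rw [mem_iInter] at hx
  exact ⟨x, mem_iInter.2 fun n => (hx n).1, (hx 0).2⟩

/-- Backward orbits in `[0, r]` are unique and convergent, so removing the repulsion basin of the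
origin leaves exactly the points with a nonzero backward limit. -/
theorem mem_sigmaSet_iff {x : Plane} : x ∈ sigmaSet (kolmogorovMap f) r ↔
    ∃ u p, IsBackwardOrbit (kolmogorovMap f) (Icc 0 r) x u ∧ Tendsto u atTop (𝓝 p) ∧ p ≠ 0 := by
  constructor
  · rintro ⟨hx, hx0⟩
    obtain ⟨u, hu⟩ := (h.mem_core_iff Subset.rfl h.mapsTo_Icc).1 hx
    obtain ⟨p, -, -, hup⟩ := h.backward_tendsto hu
    refine ⟨u, p, hu, hup, ?_⟩
    rintro rfl
    exact hx0 ⟨u, hu, hup⟩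
  · rintro ⟨u, p, hu, hup, hp⟩
    refine ⟨(h.mem_core_iff Subset.rfl h.mapsTo_Icc).2 ⟨u, hu⟩, ?_⟩
    rintro ⟨v, hv, hv0⟩
    rw [h.backward_eq hv hu] at hv0
    exact hp (tendsto_nhds_unique hup hv0)

theorem alphaSet_eq {x p : Plane} {u : ℕ → Plane}
    (hu : IsBackwardOrbit (kolmogorovMap f) (Icc 0 r) x u) (hup : Tendsto u atTop (𝓝 p)) :
    alphaSet (kolmogorovMap f) (Icc 0 r) x = {p} := by
  refine Subset.antisymm (fun z hz => ?_) ?_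
  · by_contra hzp
    obtain ⟨V, W, hV, hW, hzV, hpW, hVW⟩ := t2_separation hzp
    obtain ⟨N, hN⟩ := eventually_atTop.1 (hup.eventually_mem (hW.mem_nhds hpW))
    obtain ⟨y, hyV, hyX, m, hm, hmy⟩ := mem_closure_iff.1 (mem_iInter.1 hz N) V hV hzV
    rw [h.backward_unique hu hyX hmy] at hyV
    exact hVW.notMem_of_mem_left hyV (hN m hm)
  · rintro _ rfl
    exact mem_iInter.2 fun n => mem_closure_of_tendsto hup
      (eventually_atTop.2 ⟨n, fun m hm => ⟨(hu.2 m).1, m, hm, hu.iterate_eq m⟩⟩)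

variable {Q : Fin 2 → Plane} (hQ : IsAxisFamily f r Q)

include hQ

omit h in
theorem axis_ne_zero (i : Fin 2) : Q i ≠ 0 := fun e => by
  have := hQ.pos i
  rw [e] at this
  exact lt_irrefl _ this

omit h in
theorem axis_notMem_openQuadrant (i : Fin 2) : Q i ∉ openQuadrant := fun ho => by
  obtain ⟨j, hij⟩ := exists_ne_fin_two i
  have := ho j
  rw [hQ.zero i j hij] at this
  exact lt_irrefl _ this

theorem axis_mem_sigmaSet (i : Fin 2) : Q i ∈ sigmaSet (kolmogorovMap f) r :=
  h.mem_sigmaSet_iff.2 ⟨_, Q i, isBackwardOrbit_const (hQ.mem i) (hQ.fixed i), tendsto_const_nhds,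
    axis_ne_zero hQ i⟩

theorem mem_sigmaAxis_iff {i : Fin 2} {x : Plane} : x ∈ sigmaAxis (kolmogorovMap f) r i ↔
    ∃ u, IsBackwardOrbit (kolmogorovMap f) (Icc 0 r) x u ∧ Tendsto u atTop (𝓝 (Q i)) := by
  obtain ⟨j, hij⟩ := exists_ne_fin_two i
  constructor
  · rintro ⟨hx, hα⟩
    obtain ⟨u, p, hu, hup, hp0⟩ := h.mem_sigmaSet_iff.1 hx
    obtain ⟨p', hp', hfix, hup'⟩ := h.backward_tendsto hu
    obtain rfl := tendsto_nhds_unique hup hup'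
    rw [h.alphaSet_eq hu hup, singleton_subset_iff] at hα
    obtain ⟨-, hpi, hpj⟩ := hα
    have hpj := hpj j hij.symm
    have hpi' : 0 < p i := lt_of_le_of_ne hpi fun e =>
      hp0 (funext ((forall_fin_two_iff hij).2 ⟨e.symm, hpj⟩))
    rw [h.eq_of_fixed_axis hQ hp' hfix hij hpi' hpj] at hup
    exact ⟨u, hu, hup⟩
  · rintro ⟨u, hu, hup⟩
    refine ⟨h.mem_sigmaSet_iff.2 ⟨u, _, hu, hup, axis_ne_zero hQ i⟩, ?_⟩
    rw [h.alphaSet_eq hu hup, singleton_subset_iff]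
    exact ⟨h.axis_mem_sigmaSet hQ i, (hQ.pos i).le, fun k hk => hQ.zero i k hk.symm⟩

theorem mem_sigmaZero_iff {x : Plane} : x ∈ sigmaZero (kolmogorovMap f) r ↔
    ∃ u, ∃ p ∈ openQuadrant, p ∈ Icc 0 r ∧ kolmogorovMap f p = p ∧
      IsBackwardOrbit (kolmogorovMap f) (Icc 0 r) x u ∧ Tendsto u atTop (𝓝 p) := by
  constructor
  · rintro ⟨hx, hxA⟩
    obtain ⟨u, p, hu, hup, hp0⟩ := h.mem_sigmaSet_iff.1 hx
    obtain ⟨p', hp', hfix, hup'⟩ := h.backward_tendsto hu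
    obtain rfl := tendsto_nhds_unique hup hup'
    rcases h.fixed_cases hQ hp' hfix with h0 | ⟨i, rfl⟩ | ho
    · exact absurd h0 hp0
    · have := (h.mem_sigmaAxis_iff hQ).2 ⟨u, hu, hup⟩
      exfalso
      rcases fin_two_cases (show (0 : Fin 2) ≠ 1 by decide) i with rfl | rfl
      exacts [hxA (Or.inl this), hxA (Or.inr this)]
    · exact ⟨u, p, ho, hp', hfix, hu, hup⟩
  · rintro ⟨u, p, ho, hpX, hfix, hu, hup⟩
    have hno : ∀ i, x ∉ sigmaAxis (kolmogorovMap f) r i := by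
      intro i hi
      obtain ⟨v, hv, hvi⟩ := (h.mem_sigmaAxis_iff hQ).1 hi
      rw [h.backward_eq hv hu] at hvi
      rw [tendsto_nhds_unique hup hvi] at ho
      exact axis_notMem_openQuadrant hQ i ho
    refine ⟨h.mem_sigmaSet_iff.2 ⟨u, p, hu, hup, ?_⟩, fun hx => hx.elim (hno 0) (hno 1)⟩
    rintro rfl
    exact lt_irrefl _ (ho 0)

omit hQ in
-- Since `p = T p ≪ r`, a tail of the orbit lies in `[0, r]`, which is forward invariant. This
-- reconciles `W^u`, defined in the quadrant, with the sets defined through `[0, r]`.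
theorem backward_mem_Icc {x p : Plane} {u : ℕ → Plane}
    (hu : IsBackwardOrbit (kolmogorovMap f) quadrant x u) (hup : Tendsto u atTop (𝓝 p))
    (hp : p ∈ Icc 0 r) (hfix : kolmogorovMap f p = p) :
    IsBackwardOrbit (kolmogorovMap f) (Icc 0 r) x u := by
  refine hu.mem_of_eventually h.mapsTo_Icc ?_
  have hpr := h.maps p hp
  rw [hfix] at hpr
  have : ∀ᶠ n in atTop, ∀ i, u n i < r i := eventually_all.2 fun i =>
    (tendsto_pi_nhds.1 hup i).eventually (eventually_lt_nhds (hpr i))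
  exact this.mono fun n hn => ⟨(hu.2 n).1, fun i => (hn i).le⟩

theorem mem_unstableManifold_iff {i : Fin 2} {x : Plane} :
    x ∈ unstableManifold (kolmogorovMap f) (Q i) ↔ x ∈ sigmaAxis (kolmogorovMap f) r i := by
  rw [h.mem_sigmaAxis_iff hQ]
  constructor
  · rintro ⟨u, hu, hup⟩
    exact ⟨u, h.backward_mem_Icc hu hup (hQ.mem i) (hQ.fixed i), hup⟩
  · rintro ⟨u, hu, hup⟩
    exact ⟨u, hu.mono Icc_subset_quadrant, hup⟩

theorem axis_mem_sigmaAxis (i : Fin 2) : Q i ∈ sigmaAxis (kolmogorovMap f) r i :=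
  (h.mem_sigmaAxis_iff hQ).2
    ⟨_, isBackwardOrbit_const (hQ.mem i) (hQ.fixed i), tendsto_const_nhds⟩

/-- The set `Σ_H` (or `Σ_V`) is a graph of a monotone function over the other axis. -/
theorem sigmaAxis_order {i j : Fin 2} (hij : i ≠ j) {x y : Plane}
    (hx : x ∈ sigmaAxis (kolmogorovMap f) r i) (hy : y ∈ sigmaAxis (kolmogorovMap f) r i)
    (hj : x j ≤ y j) : x i ≤ y i ∧ (x j = y j → x = y) := by
  obtain ⟨u, hu, hup⟩ := (h.mem_sigmaAxis_iff hQ).1 hx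
  obtain ⟨v, hv, hvp⟩ := (h.mem_sigmaAxis_iff hQ).1 hy
  have hui := tendsto_pi_nhds.1 hup
  have hvi := tendsto_pi_nhds.1 hvp
  -- If `y i ≤ x i` as well, the points are `K`-related with the same backward limit `Q i`, and
  -- separation in direction `i` applies.
  have key : y i ≤ x i → y i = x i := fun hi => h.backward_separation hv hu hij hi hj
    (hQ.mem i) (hQ.fixed i) (hQ.pos i) (hvi i) (hui i) (hvi j)
  have hle : x i ≤ y i := by
    by_contra hlt
    exact hlt (key (not_le.1 hlt).le).ge
  refine ⟨hle, fun e => funext ((forall_fin_two_iff hij).2 ⟨?_, e⟩)⟩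
  exact h.backward_separation hu hv hij hle e.ge
    (hQ.mem i) (hQ.fixed i) (hQ.pos i) (hui i) (hvi i) (hui j)

theorem unstableManifold_subset (i : Fin 2) :
    unstableManifold (kolmogorovMap f) (Q i) \ {Q i} ⊆ openQuadrant := by
  rintro x ⟨hx, hxQ⟩
  obtain ⟨j, hij⟩ := exists_ne_fin_two i
  have hxA := (h.mem_unstableManifold_iff hQ).1 hx
  obtain ⟨u, hu, hup⟩ := (h.mem_sigmaAxis_iff hQ).1 hxA
  have hxX : x ∈ Icc 0 r := hu.1 ▸ (hu.2 0).1
  have h1 := h.sigmaAxis_order hQ hij (h.axis_mem_sigmaAxis hQ i) hxA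
    (by rw [hQ.zero i j hij]; exact hxX.1 j)
  refine (forall_fin_two_iff hij).2 ⟨(hQ.pos i).trans_le h1.1, lt_of_le_of_ne (hxX.1 j) fun e => ?_⟩
  exact hxQ (h1.2 (by rw [hQ.zero i j hij]; exact e)).symm

/-- Off the axis, convergence to `Q i` is impossible: the transversal growth rate at `Q i` exceeds
one, so a positive transversal coordinate is eventually nondecreasing and cannot tend to zero. -/
theorem stableManifold_eq (i : Fin 2) :
    stableManifold (kolmogorovMap f) (Q i) = posHalfAxis i := by
  obtain ⟨j, hij⟩ := exists_ne_fin_two i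
  refine Subset.antisymm ?_ fun x hx =>
    ⟨(forall_fin_two_iff hij).2 ⟨hx.1.le, (hx.2 j hij.symm).ge⟩, h.tendsto_axis hQ hx⟩
  rintro x ⟨hxq, hlim⟩
  have hxn : ∀ n, (kolmogorovMap f)^[n] x ∈ quadrant := fun n => h.mapsTo_quadrant.iterate n hxq
  have hlim' := tendsto_pi_nhds.1 hlim
  constructor
  · refine lt_of_le_of_ne (hxq i) fun e => ?_
    have hz : ∀ n, (kolmogorovMap f)^[n] x i = 0 := by
      intro n
      induction n with
      | zero => exact e.symm
      | succ n ih => rw [Function.iterate_succ_apply', kolmogorovMap, ih, zero_mul]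
    have := tendsto_nhds_unique (hlim' i) (tendsto_const_nhds.congr fun n => (hz n).symm)
    exact (hQ.pos i).ne' this
  · intro k hk
    obtain rfl : k = j := (fin_two_cases hij k).resolve_left hk
    by_contra hne
    have hpos : ∀ n, 0 < (kolmogorovMap f)^[n] x k := by
      intro n
      induction n with
      | zero => exact lt_of_le_of_ne (hxq k) (Ne.symm hne)
      | succ n ih =>
        rw [Function.iterate_succ_apply']
        exact mul_pos ih (h.pos _ (hxn n) k)
    have hfQ : 1 < f (Q i) k := h.one_lt_growth hQ (hQ.mem i)
      (by rw [hQ.zero i k hij]; exact hQ.pos k)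
    have hfc : Tendsto (fun n => f ((kolmogorovMap f)^[n] x) k) atTop (𝓝 (f (Q i) k)) :=
      tendsto_pi_nhds.1 ((h.continuousOn _ (Icc_subset_quadrant (hQ.mem i))).tendsto.comp
        (tendsto_nhdsWithin_iff.2 ⟨hlim, Eventually.of_forall hxn⟩)) k
    obtain ⟨N, hN⟩ := eventually_atTop.1 (hfc.eventually (eventually_gt_nhds hfQ))
    have hmono : Monotone fun n => (kolmogorovMap f)^[n + N] x k :=
      monotone_nat_of_le_succ fun n => by
        rw [show n + 1 + N = n + N + 1 by omega, Function.iterate_succ_apply']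
        exact le_mul_of_one_le_right (hpos _).le (hN _ (by omega)).le
    have := hmono.ge_of_tendsto ((tendsto_add_atTop_iff_nat N).2 (hlim' k)) 0
    rw [hQ.zero i k hij] at this
    exact absurd (hpos (0 + N)) (not_lt.2 this)

variable {p₀ p₁ : Plane} (hp : IsExtremalPair f r Q p₀ p₁)

include hp

/-- A point `a` strictly below every interior fixed point is eventually below `u n`. Then `Tⁿ a ≤
x`, while `Tⁿ a → p₀`. -/
theorem least_le_of_backward_tendsto {x p : Plane} {u : ℕ → Plane}
    (huX : IsBackwardOrbit (kolmogorovMap f) (Icc 0 r) x u) (hup : Tendsto u atTop (𝓝 p))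
    (hpX : p ∈ Icc 0 r) (hfix : kolmogorovMap f p = p) (hpo : p ∈ openQuadrant) : p₀ ≤ x := by
  let a : Plane := fun k => Q k k / 2
  have hao : a ∈ openQuadrant := fun k => half_pos (hQ.pos k)
  have haX : a ∈ Icc 0 r := ⟨fun k => (hao k).le, fun k =>
    (half_le_self (hQ.pos k).le).trans ((hQ.mem k).2 k)⟩
  have hap : ∀ k, a k < p k := fun k =>
    (half_lt_self (hQ.pos k)).trans_le (h.axis_le_of_fixed hQ hpX hfix (hpo k))
  have hev : ∀ᶠ n in atTop, ∀ k, a k < u n k := eventually_all.2 fun k =>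
    (tendsto_pi_nhds.1 hup k).eventually (eventually_gt_nhds (hap k))
  refine le_of_tendsto (hp.lower a hao fun k => half_le_self (hQ.pos k).le)
    (hev.mono fun n hn => ?_)
  have := h.iterate_mono haX (huX.2 n).1 (fun k => (hn k).le) n
  rwa [huX.iterate_eq] at this

/-- A backward limit inside `[Q i, p₀]` is either `Q i` or interior, and an interior limit forces
`p₀ ≤ x`. Adjoining `p₀` closes up the axis piece, so that compactness and connectedness can be
used. -/
theorem sigmaAxis_union_eq_core (i : Fin 2) :
    sigmaAxis (kolmogorovMap f) r i ∪ {p₀} = core (kolmogorovMap f) (Icc (Q i) p₀) := by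
  obtain ⟨j, hij⟩ := exists_ne_fin_two i
  have hEX : Icc (Q i) p₀ ⊆ Icc 0 r := Icc_subset_Icc (hQ.mem i).1 hp.mem₀.2
  have hp₀ := hp.open₀ hQ
  have hQp : Q i ≤ p₀ :=
    (forall_fin_two_iff hij).2 ⟨hp.axis_le i, by rw [hQ.zero i j hij]; exact (hp₀ j).le⟩
  have hE : MapsTo (kolmogorovMap f) (Icc (Q i) p₀) (Icc (Q i) p₀) := fun x hx =>
    ⟨(hQ.fixed i).ge.trans (h.mono _ (hQ.mem i) _ (hEX hx) hx.1),
      (h.mono _ (hEX hx) _ hp.mem₀ hx.2).trans hp.fixed₀.le⟩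
  ext x
  rw [h.mem_core_iff hEX hE]
  constructor
  · rintro (hx | rfl)
    · obtain ⟨u, hu, hup⟩ := (h.mem_sigmaAxis_iff hQ).1 hx
      have huA : ∀ n, u n ∈ sigmaAxis (kolmogorovMap f) r i := fun n =>
        (h.mem_sigmaAxis_iff hQ).2 ⟨_, hu.shift n, (tendsto_add_atTop_iff_nat n).2 hup⟩
      have hlow : ∀ n, Q i ≤ u n := fun n => by
        have hj : Q i j ≤ u n j := by rw [hQ.zero i j hij]; exact (hu.2 n).1.1 j
        exact (forall_fin_two_iff hij).2
          ⟨(h.sigmaAxis_order hQ hij (h.axis_mem_sigmaAxis hQ i) (huA n) hj).1, hj⟩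
      have hupi := tendsto_pi_nhds.1 hup
      have hclaim : ∀ n, u n j < p₀ j → u n ≤ p₀ := by
        intro n hn
        refine (forall_fin_two_iff hij).2 ⟨?_, hn.le⟩
        -- If `u n` exceeded `p₀` in direction `i`, it would be `K`-related to `p₀`. Its backward
        -- limit then gives `p₀ i ≤ Q i i`, hence equality, and separation from the constant orbit
        -- of `p₀` yields a contradiction.
        by_contra hlt
        have hlt := not_le.1 hlt
        have hc := isBackwardOrbit_const hp.mem₀ hp.fixed₀
        have hret := h.backward_retrotone hc (hu.shift n) hij hlt.le hn.le
        have hq : Q i i = p₀ i := le_antisymm (hp.axis_le i)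
          (ge_of_tendsto ((tendsto_add_atTop_iff_nat n).2 (hupi i))
            (Eventually.of_forall fun m => (hret m).1))
        have := h.backward_separation hc (hu.shift n) hij hlt.le hn.le hp.mem₀ hp.fixed₀ (hp₀ i)
          tendsto_const_nhds (by rw [← hq]; exact (tendsto_add_atTop_iff_nat n).2 (hupi i))
          tendsto_const_nhds
        exact hlt.ne this
      refine ⟨u, hu.mem_of_eventually hE ?_⟩
      have hlt : Q i j < p₀ j := by rw [hQ.zero i j hij]; exact hp₀ j
      exact ((hupi j).eventually (eventually_lt_nhds hlt)).mono fun n hn => ⟨hlow n, hclaim n hn⟩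
    · exact ⟨_, isBackwardOrbit_const ⟨hQp, le_rfl⟩ hp.fixed₀⟩
  · rintro ⟨u, hu⟩
    have huX := hu.mono hEX
    obtain ⟨p, hpX, hfix, hup⟩ := h.backward_tendsto huX
    have hpE : p ∈ Icc (Q i) p₀ :=
      isClosed_Icc.mem_of_tendsto hup (Eventually.of_forall fun n => (hu.2 n).1)
    have hpi : 0 < p i := (hQ.pos i).trans_le (hpE.1 i)
    rcases (hpX.1 j).eq_or_lt with hpj | hpj
    · rw [h.eq_of_fixed_axis hQ hpX hfix hij hpi hpj.symm] at hup
      exact Or.inl ((h.mem_sigmaAxis_iff hQ).2 ⟨u, huX, hup⟩)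
    · have hpo : p ∈ openQuadrant := (forall_fin_two_iff hij).2 ⟨hpi, hpj⟩
      right
      have hx : x ∈ Icc (Q i) p₀ := hu.1 ▸ (hu.2 0).1
      exact le_antisymm hx.2 (h.least_le_of_backward_tendsto hQ hp huX hup hpX hfix hpo)

end IsRetrotoneSystem

/-! ### The pieces of `Σ` as monotone curves, and the global attractor -/

namespace IsRetrotoneSystem

variable {f : Plane → Plane} {r : Plane} (h : IsRetrotoneSystem f r)

include h

variable {Q : Fin 2 → Plane} (hQ : IsAxisFamily f r Q)

include hQ

variable {p₀ p₁ : Plane} (hp : IsExtremalPair f r Q p₀ p₁)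

include hp in
-- With equality, `x` would be `K`-related to `p₀`; the backward orbit would keep its `j`-th
-- coordinate above `p₀ j > 0` although it tends to zero.
theorem sigmaAxis_apply_lt {i j : Fin 2} (hij : i ≠ j) {x : Plane}
    (hx : x ∈ sigmaAxis (kolmogorovMap f) r i) : x j < p₀ j := by
  have hmem : x ∈ core (kolmogorovMap f) (Icc (Q i) p₀) := by
    rw [← h.sigmaAxis_union_eq_core hQ hp]; exact Or.inl hx
  obtain ⟨y, hy, rfl⟩ := mem_iInter.1 hmem 0
  obtain ⟨u, hu, hup⟩ := (h.mem_sigmaAxis_iff hQ).1 hx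
  refine lt_of_le_of_ne (hy.2 j) fun e => ?_
  have hret := h.backward_retrotone hu (isBackwardOrbit_const hp.mem₀ hp.fixed₀) hij (hy.2 i) e.ge
  have := ge_of_tendsto (tendsto_pi_nhds.1 hup j) (Eventually.of_forall fun n => (hret n).2)
  rw [hQ.zero i j hij] at this
  exact absurd (hp.open₀ hQ j) (not_lt.2 this)

include hp in
theorem isCurve_sigmaAxis (i : Fin 2) : IsCurve (sigmaAxis (kolmogorovMap f) r i) := by
  obtain ⟨j, hij⟩ := exists_ne_fin_two i
  have hcore := h.sigmaAxis_union_eq_core hQ hp i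
  have hp₀ := hp.open₀ hQ
  have hinj : InjOn (fun x : Plane => x j) (core (kolmogorovMap f) (Icc (Q i) p₀)) := by
    rw [← hcore]
    rintro x (hx | rfl) y (hy | rfl) hxy
    · exact (h.sigmaAxis_order hQ hij hx hy hxy.le).2 hxy
    · exact absurd hxy (h.sigmaAxis_apply_lt hQ hp hij hx).ne
    · exact absurd hxy (h.sigmaAxis_apply_lt hQ hp hij hy).ne'
    · rfl
  have hQp : Q i ≤ p₀ :=
    (forall_fin_two_iff hij).2 ⟨hp.axis_le i, by rw [hQ.zero i j hij]; exact (hp₀ j).le⟩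
  have him := h.Icc_subset_image_core (hQ.mem i) hp.mem₀ hQp (hQ.fixed i) hp.fixed₀ j
  rw [hQ.zero i j hij] at him
  obtain ⟨γ, hγc, hγ⟩ := exists_continuousOn_section (h.isCompact_core
    (Icc_subset_Icc (hQ.mem i).1 hp.mem₀.2) isCompact_Icc) hinj him
  refine ⟨Ico 0 (p₀ j), γ, ordConnected_Ico, ?_, hγc.mono Ico_subset_Icc_self, ?_, ?_⟩
  · exact ⟨0, ⟨le_rfl, hp₀ j⟩, p₀ j / 2, ⟨(half_pos (hp₀ j)).le, half_lt_self (hp₀ j)⟩,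
      (half_pos (hp₀ j)).ne⟩
  · intro s hs t ht hst
    rw [← (hγ s (Ico_subset_Icc_self hs)).2, ← (hγ t (Ico_subset_Icc_self ht)).2, hst]
  · ext x
    constructor
    · rintro ⟨s, hs, rfl⟩
      obtain ⟨h1, h2⟩ := hγ s (Ico_subset_Icc_self hs)
      rw [← hcore] at h1
      refine h1.resolve_right fun e => ?_
      rw [mem_singleton_iff.1 e] at h2
      exact hs.2.ne' h2
    · intro hx
      have hxc : x ∈ core (kolmogorovMap f) (Icc (Q i) p₀) := hcore ▸ Or.inl hx
      have hs : x j ∈ Ico 0 (p₀ j) := by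
        refine ⟨?_, h.sigmaAxis_apply_lt hQ hp hij hx⟩
        obtain ⟨u, hu, -⟩ := (h.mem_sigmaAxis_iff hQ).1 hx
        exact hu.1 ▸ (hu.2 0).1.1 j
      obtain ⟨h1, h2⟩ := hγ _ (Ico_subset_Icc_self hs)
      exact ⟨x j, hs, hinj h1 hxc h2⟩

theorem sigmaAxis_lt {i j : Fin 2} (hij : i ≠ j) {x y : Plane}
    (hx : x ∈ sigmaAxis (kolmogorovMap f) r i) (hy : y ∈ sigmaAxis (kolmogorovMap f) r i)
    (hne : x ≠ y) (hj : x j ≤ y j) : x ≤ y ∧ x j < y j := by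
  obtain ⟨h1, h2⟩ := h.sigmaAxis_order hQ hij hx hy hj
  exact ⟨(forall_fin_two_iff hij).2 ⟨h1, hj⟩, lt_of_le_of_ne hj fun e => hne (h2 e)⟩

theorem orderedBy_sigmaAxis (i : Fin 2) :
    OrderedBy (· < ·) (sigmaAxis (kolmogorovMap f) r i) := by
  obtain ⟨j, hij⟩ := exists_ne_fin_two i
  intro x hx y hy hne
  rcases le_total (x j) (y j) with hj | hj
  · exact Or.inl (lt_of_le_of_ne (h.sigmaAxis_lt hQ hij hx hy hne hj).1 hne)
  · exact Or.inr (lt_of_le_of_ne (h.sigmaAxis_lt hQ hij hy hx hne.symm hj).1 hne.symm)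

/-- The preimages of two distinct points are strictly ordered in coordinate `j`; one application of
the map turns this into strictness in coordinate `i`. -/
theorem orderedBy_strongLT_sigmaAxis {i j : Fin 2} (hij : i ≠ j)
    (hstrict : ∀ x ∈ Icc 0 r, ∀ y ∈ Icc 0 r, x ≤ y → x j < y j → 0 < x i →
      kolmogorovMap f x i < kolmogorovMap f y i) :
    OrderedBy StrongLT (sigmaAxis (kolmogorovMap f) r i) := by
  have key : ∀ x ∈ sigmaAxis (kolmogorovMap f) r i, ∀ y ∈ sigmaAxis (kolmogorovMap f) r i,
      x ≠ y → x j ≤ y j → StrongLT x y := by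
    intro x hx y hy hne hj
    obtain ⟨u, hu, hup⟩ := (h.mem_sigmaAxis_iff hQ).1 hx
    obtain ⟨v, hv, hvp⟩ := (h.mem_sigmaAxis_iff hQ).1 hy
    have hu1 : u 1 ∈ sigmaAxis (kolmogorovMap f) r i :=
      (h.mem_sigmaAxis_iff hQ).2 ⟨_, hu.shift 1, (tendsto_add_atTop_iff_nat 1).2 hup⟩
    have hv1 : v 1 ∈ sigmaAxis (kolmogorovMap f) r i :=
      (h.mem_sigmaAxis_iff hQ).2 ⟨_, hv.shift 1, (tendsto_add_atTop_iff_nat 1).2 hvp⟩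
    have hux : kolmogorovMap f (u 1) = x := (hu.2 0).2.trans hu.1
    have hvy : kolmogorovMap f (v 1) = y := (hv.2 0).2.trans hv.1
    have hne1 : u 1 ≠ v 1 := fun e => hne (by rw [← hux, ← hvy, e])
    have hlt := (h.sigmaAxis_lt hQ hij hx hy hne hj).2
    have hj1 : u 1 j ≤ v 1 j := by
      by_contra hcon
      have := h.mono _ (hv.2 1).1 _ (hu.2 1).1
        (h.sigmaAxis_lt hQ hij hv1 hu1 hne1.symm (not_le.1 hcon).le).1 j
      rw [hux, hvy] at this
      exact absurd hlt (not_lt.2 this)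
    obtain ⟨hle1, hlt1⟩ := h.sigmaAxis_lt hQ hij hu1 hv1 hne1 hj1
    have hpos : 0 < u 1 i := (hQ.pos i).trans_le (h.sigmaAxis_order hQ hij
      (h.axis_mem_sigmaAxis hQ i) hu1 (by rw [hQ.zero i j hij]; exact (hu.2 1).1.1 j)).1
    refine (forall_fin_two_iff hij).2 ⟨?_, hlt⟩
    have := hstrict _ (hu.2 1).1 _ (hv.2 1).1 hle1 hlt1 hpos
    rwa [hux, hvy] at this
  intro x hx y hy hne
  rcases le_total (x j) (y j) with hj | hj
  · exact Or.inl (key x hx y hy hne hj)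
  · exact Or.inr (key y hy x hx hne.symm hj)

/-- Points not related by `≪` are `K`-related. So are their backward limits, which therefore
coincide, and separation in both directions makes the points equal. -/
theorem orderedBy_sigmaZero : OrderedBy StrongLT (sigmaZero (kolmogorovMap f) r) := by
  have key : ∀ x ∈ sigmaZero (kolmogorovMap f) r, ∀ y ∈ sigmaZero (kolmogorovMap f) r,
      ∀ i j, i ≠ j → x i ≤ y i → y j ≤ x j → x = y := by
    intro x hx y hy i j hij hi hj
    obtain ⟨u, p, hpo, hpX, hfix, hu, hup⟩ := (h.mem_sigmaZero_iff hQ).1 hx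
    obtain ⟨v, p', hpo', hpX', hfix', hv, hvp⟩ := (h.mem_sigmaZero_iff hQ).1 hy
    have hui := tendsto_pi_nhds.1 hup
    have hvi := tendsto_pi_nhds.1 hvp
    have hret := h.backward_retrotone hu hv hij hi hj
    obtain rfl : p = p' := h.fixed_eq_of_typeK hpX hfix hpo hpX' hfix' hpo' hij
      (le_of_tendsto_of_tendsto' (hui i) (hvi i) fun n => (hret n).1)
      (le_of_tendsto_of_tendsto' (hvi j) (hui j) fun n => (hret n).2)
    refine funext ((forall_fin_two_iff hij).2 ⟨?_, ?_⟩)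
    · exact h.backward_separation hu hv hij hi hj hpX hfix (hpo i) (hui i) (hvi i) (hui j)
    · exact (h.backward_separation hv hu hij.symm hj hi hpX hfix (hpo j) (hvi j) (hui j)
        (hvi i)).symm
  intro x hx y hy hne
  have h01 : (0 : Fin 2) ≠ 1 := by decide
  by_cases h0 : x 0 < y 0
  · refine Or.inl ((forall_fin_two_iff h01).2 ⟨h0, ?_⟩)
    by_contra h1
    exact hne (key x hx y hy 0 1 h01 h0.le (not_lt.1 h1))
  · refine Or.inr ((forall_fin_two_iff h01).2 ⟨?_, ?_⟩) <;> by_contra h1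
    · have e := le_antisymm (not_lt.1 h0) (not_lt.1 h1)
      rcases le_total (x 1) (y 1) with h2 | h2
      · exact hne (key y hy x hx 0 1 h01 e.le h2).symm
      · exact hne (key x hx y hy 0 1 h01 e.ge h2)
    · exact hne (key x hx y hy 1 0 h01.symm (not_lt.1 h1) (not_lt.1 h0))

include hp

theorem sigmaZero_eq_core :
    sigmaZero (kolmogorovMap f) r = core (kolmogorovMap f) (Icc p₀ p₁) := by
  have hEX : Icc p₀ p₁ ⊆ Icc 0 r := Icc_subset_Icc hp.mem₀.1 hp.mem₁.2
  have hE : MapsTo (kolmogorovMap f) (Icc p₀ p₁) (Icc p₀ p₁) := fun x hx =>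
    ⟨hp.fixed₀.ge.trans (h.mono _ hp.mem₀ _ (hEX hx) hx.1),
      (h.mono _ (hEX hx) _ hp.mem₁ hx.2).trans hp.fixed₁.le⟩
  ext x
  rw [h.mem_core_iff hEX hE, h.mem_sigmaZero_iff hQ]
  constructor
  · rintro ⟨u, p, hpo, hpX, hfix, hu, hup⟩
    exact ⟨u, hu.1, fun n => ⟨⟨h.least_le_of_backward_tendsto hQ hp (hu.shift n)
      ((tendsto_add_atTop_iff_nat n).2 hup) hpX hfix hpo,
      h.backward_le hp.upper (hu.shift n)⟩, (hu.2 n).2⟩⟩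
  · rintro ⟨u, hu⟩
    obtain ⟨p, hpX, hfix, hup⟩ := h.backward_tendsto (hu.mono hEX)
    have hpE : p ∈ Icc p₀ p₁ :=
      isClosed_Icc.mem_of_tendsto hup (Eventually.of_forall fun n => (hu.2 n).1)
    exact ⟨u, p, fun i => (hp.open₀ hQ i).trans_le (hpE.1 i), hpX, hfix, hu.mono hEX, hup⟩

theorem sigmaZero_eq_singleton (heq : p₁ = p₀) : sigmaZero (kolmogorovMap f) r = {p₀} := by
  rw [h.sigmaZero_eq_core hQ hp, heq, Icc_self]
  ext x
  simp only [core, image_singleton, Function.iterate_fixed hp.fixed₀, iInter_const]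

theorem isMonotoneCurveFromTo_sigmaZero (hlt : StrongLT p₀ p₁) :
    IsMonotoneCurveFromTo StrongLT p₀ p₁ (sigmaZero (kolmogorovMap f) r) := by
  refine ⟨?_, h.orderedBy_sigmaZero hQ⟩
  have hcore := h.sigmaZero_eq_core hQ hp
  have hinj : InjOn (fun x : Plane => x 0) (sigmaZero (kolmogorovMap f) r) := by
    intro x hx y hy hxy
    by_contra hne
    rcases h.orderedBy_sigmaZero hQ x hx y hy hne with hs | hs
    exacts [(hs 0).ne hxy, (hs 0).ne' hxy]
  have hcpt : IsCompact (sigmaZero (kolmogorovMap f) r) :=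
    hcore ▸ h.isCompact_core (Icc_subset_Icc hp.mem₀.1 hp.mem₁.2) isCompact_Icc
  have him := h.Icc_subset_image_core hp.mem₀ hp.mem₁ hlt.le hp.fixed₀ hp.fixed₁ 0
  rw [← hcore] at him
  obtain ⟨γ, hγc, hγ⟩ := exists_continuousOn_section hcpt hinj him
  have hfixmem : ∀ p ∈ Icc 0 r, p ∈ openQuadrant → kolmogorovMap f p = p →
      p ∈ sigmaZero (kolmogorovMap f) r := fun p hpX hpo hfix =>
    (h.mem_sigmaZero_iff hQ).2
      ⟨_, p, hpo, hpX, hfix, isBackwardOrbit_const hpX hfix, tendsto_const_nhds⟩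
  have hd : 0 < p₁ 0 - p₀ 0 := sub_pos.2 (hlt 0)
  have hpar : MapsTo (fun t : ℝ => p₀ 0 + t * (p₁ 0 - p₀ 0)) (Icc 0 1) (Icc (p₀ 0) (p₁ 0)) := by
    intro t ht
    constructor <;> nlinarith [ht.1, ht.2]
  refine ⟨fun t => γ (p₀ 0 + t * (p₁ 0 - p₀ 0)), hγc.comp (by fun_prop) hpar, ?_, ?_, ?_, ?_⟩
  · intro s hs t ht hst
    have e := (hγ _ (hpar hs)).2.symm.trans ((congrFun hst 0).trans (hγ _ (hpar ht)).2)
    exact mul_right_cancel₀ hd.ne' (add_left_cancel e)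
  · ext x
    constructor
    · rintro ⟨t, ht, rfl⟩
      exact (hγ _ (hpar ht)).1
    · intro hx
      obtain ⟨y, hy, rfl⟩ := mem_iInter.1 (hcore ▸ hx : x ∈ core (kolmogorovMap f) (Icc p₀ p₁)) 0
      have hy' : y ∈ sigmaZero (kolmogorovMap f) r := hx
      have e : p₀ 0 + (y 0 - p₀ 0) / (p₁ 0 - p₀ 0) * (p₁ 0 - p₀ 0) = y 0 := by
        field_simp
        ring
      have h0 := hy.1 0
      have h1 := hy.2 0
      refine ⟨(y 0 - p₀ 0) / (p₁ 0 - p₀ 0), ⟨div_nonneg (by linarith) hd.le,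
        (div_le_one hd).2 (by linarith)⟩, ?_⟩
      simp only [e]
      obtain ⟨g1, g2⟩ := hγ (y 0) ⟨h0, h1⟩
      exact hinj g1 hy' g2
  · obtain ⟨g1, g2⟩ := hγ (p₀ 0) ⟨le_rfl, (hlt 0).le⟩
    simp only [zero_mul, add_zero]
    exact hinj g1 (hfixmem _ hp.mem₀ (hp.open₀ hQ) hp.fixed₀) g2
  · obtain ⟨g1, g2⟩ := hγ (p₁ 0) ⟨(hlt 0).le, le_rfl⟩
    simp only [one_mul, add_sub_cancel]
    exact hinj g1 (hfixmem _ hp.mem₁ (h.open₁ hQ hp) hp.fixed₁) g2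

omit hp in
/-- The set of points of `[0, r]` that are bounded away from the origin is forward invariant. -/
theorem mapsTo_awayFromZero {η : ℝ} (hη0 : 0 < η) (hη : ∀ i, η < Q i i) :
    MapsTo (kolmogorovMap f) {x ∈ Icc 0 r | ∃ i, η ≤ x i} {x ∈ Icc 0 r | ∃ i, η ≤ x i} := by
  rintro x ⟨hx, i, hi⟩
  obtain ⟨j, hij⟩ := exists_ne_fin_two i
  refine ⟨h.mapsTo_Icc hx, i, ?_⟩
  -- The comparison point on axis `i` at height `η < Q i i`, where the growth rate is at least one.
  let y : Plane := Function.update 0 i η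
  have hy : y ∈ Icc 0 r := update_mem_Icc h.zero_mem i ⟨hη0.le, (hη i).le.trans ((hQ.mem i).2 i)⟩
  have hyi : y i = η := by simp [y]
  have hyx : y ≤ x := (forall_fin_two_iff hij).2
    ⟨by rwa [hyi], by simpa [y, hij.symm] using hx.1 j⟩
  have h1 := h.one_le_growth hQ hy (i := i) (by rw [hyi]; exact (hη i).le)
  calc η ≤ y i * f y i := by rw [hyi]; exact le_mul_of_one_le_right hη0.le h1
    _ ≤ kolmogorovMap f x i := h.mono _ hy _ hx hyx i

omit h hQ hp in
theorem isCompact_awayFromZero (r : Plane) (η : ℝ) :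
    IsCompact {x ∈ Icc 0 r | ∃ i, η ≤ x i} := by
  refine isCompact_Icc.inter_right (t := {x : Plane | ∃ i, η ≤ x i}) ?_
  have : {x : Plane | ∃ i, η ≤ x i} = ⋃ i, {x : Plane | η ≤ x i} := by ext; simp
  rw [this]
  exact isClosed_iUnion_of_finite fun i => isClosed_le continuous_const (continuous_apply i)

omit hp in
-- Nonzero fixed points have some coordinate at least `Q i i > η`, so backward orbits of `Σ` stay
-- away from the origin. The freedom in `η` lets a given compact set be absorbed later.
theorem sigmaSet_eq_core {η : ℝ} (hη0 : 0 < η) (hη : ∀ i, η < Q i i) :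
    sigmaSet (kolmogorovMap f) r =
      core (kolmogorovMap f) {x ∈ Icc 0 r | ∃ i, η ≤ x i} := by
  have hEX : {x ∈ Icc 0 r | ∃ i, η ≤ x i} ⊆ Icc 0 r := fun x hx => hx.1
  have hE := h.mapsTo_awayFromZero hQ hη0 hη
  ext x
  rw [h.mem_core_iff hEX hE, h.mem_sigmaSet_iff]
  constructor
  · rintro ⟨u, p, hu, hup, hp0⟩
    obtain ⟨p', hpX, hfix, hup'⟩ := h.backward_tendsto hu
    obtain rfl := tendsto_nhds_unique hup hup'
    obtain ⟨i, hi⟩ : ∃ i, 0 < p i := by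
      by_contra hcon
      push Not at hcon
      exact hp0 (funext fun i => le_antisymm (hcon i) (hpX.1 i))
    have hpi := (hη i).trans_le (h.axis_le_of_fixed hQ hpX hfix hi)
    refine ⟨u, hu.mem_of_eventually hE ?_⟩
    exact ((tendsto_pi_nhds.1 hup i).eventually (eventually_gt_nhds hpi)).mono fun n hn =>
      ⟨(hu.2 n).1, i, le_of_lt hn⟩
  · rintro ⟨u, hu⟩
    obtain ⟨p, -, -, hup⟩ := h.backward_tendsto (hu.mono hEX)
    refine ⟨u, p, hu.mono hEX, hup, ?_⟩
    rintro rfl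
    obtain ⟨-, i, hi⟩ := (isCompact_awayFromZero r η).isClosed.mem_of_tendsto hup
      (Eventually.of_forall fun n => (hu.2 n).1)
    exact absurd hη0 (not_lt.2 hi)

omit hp in
theorem isGlobalAttractorOn_sigmaSet :
    IsGlobalAttractorOn (kolmogorovMap f) (quadrant \ {0}) (sigmaSet (kolmogorovMap f) r) := by
  have hqmin : 0 < min (Q 0 0) (Q 1 1) := lt_min (hQ.pos 0) (hQ.pos 1)
  have hmin : ∀ η, η < min (Q 0 0) (Q 1 1) → ∀ i, η < Q i i := fun η hη =>
    (forall_fin_two_iff (i := 0) (j := 1) (by decide)).2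
      ⟨hη.trans_le (min_le_left _ _), hη.trans_le (min_le_right _ _)⟩
  refine ⟨⟨Q 0, h.axis_mem_sigmaSet hQ 0⟩, ?_, ?_, ?_, ?_⟩
  · rw [h.sigmaSet_eq_core hQ (half_pos hqmin) (hmin _ (half_lt_self hqmin))]
    exact h.isCompact_core (fun x hx => hx.1) (isCompact_awayFromZero r _)
  · rintro x ⟨hx, hx0⟩
    obtain ⟨y, hy, rfl⟩ := mem_iInter.1 hx 0
    refine ⟨Icc_subset_quadrant hy, fun e => hx0 ?_⟩
    obtain rfl : y = 0 := e
    exact ⟨fun _ => 0, isBackwardOrbit_const h.zero_mem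
      (funext fun i => by simp [kolmogorovMap]), tendsto_const_nhds⟩
  · ext x
    constructor
    · rintro ⟨y, hy, rfl⟩
      obtain ⟨u, p, hu, hup, hp0⟩ := h.mem_sigmaSet_iff.1 hy
      have hyX : y ∈ Icc 0 r := hu.1 ▸ (hu.2 0).1
      exact h.mem_sigmaSet_iff.2
        ⟨_, p, hu.cons (h.mapsTo_Icc hyX), (tendsto_add_atTop_iff_nat 1).1 hup, hp0⟩
    · intro hx
      obtain ⟨u, p, hu, hup, hp0⟩ := h.mem_sigmaSet_iff.1 hx
      exact ⟨u 1, h.mem_sigmaSet_iff.2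
        ⟨_, p, hu.shift 1, (tendsto_add_atTop_iff_nat 1).2 hup, hp0⟩, (hu.2 0).2.trans hu.1⟩
  · intro B hB hBX U hU hSU
    have hBq : B ⊆ quadrant := fun x hx => (hBX hx).1
    obtain ⟨N, hN⟩ := h.exists_iterate_mem_of_isCompact hB hBq
    have hpos : ∀ n, ∀ x ∈ quadrant, x ≠ 0 → (kolmogorovMap f)^[n] x ≠ 0 := by
      intro n
      induction n with
      | zero => exact fun x _ hx => hx
      | succ n ih =>
        intro x hxq hx
        rw [Function.iterate_succ_apply]
        refine ih _ (h.mapsTo_quadrant hxq) fun e => hx (funext fun i => ?_)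
        have := congrFun e i
        simp only [kolmogorovMap, Pi.zero_apply, mul_eq_zero] at this
        exact this.resolve_right (h.pos x hxq i).ne'
    -- After `N` steps the compact set `B` lies in `[0, r]` and still avoids the origin, so its
    -- larger coordinate has a positive minimum there.
    obtain ⟨η, hη0, hη, hBη⟩ : ∃ η, 0 < η ∧ η < min (Q 0 0) (Q 1 1) ∧
        ∀ x ∈ B, ∃ i, η ≤ (kolmogorovMap f)^[N] x i := by
      rcases B.eq_empty_or_nonempty with rfl | hBne
      · exact ⟨_, half_pos hqmin, half_lt_self hqmin, by simp⟩
      have hc := continuousOn_pi.1 ((h.continuousOn_iterate N).mono hBq)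
      obtain ⟨x₀, hx₀, hmin₀⟩ := hB.exists_isMinOn hBne
        (f := fun x => max ((kolmogorovMap f)^[N] x 0) ((kolmogorovMap f)^[N] x 1))
        ((hc 0).sup (hc 1))
      have hm : 0 < max ((kolmogorovMap f)^[N] x₀ 0) ((kolmogorovMap f)^[N] x₀ 1) := by
        by_contra hcon
        have hcon := max_le_iff.1 (not_lt.1 hcon)
        refine hpos N x₀ (hBq hx₀) (hBX hx₀).2 (funext fun i => le_antisymm ?_ ((hN x₀ hx₀).1 i))
        exact (forall_fin_two_iff (i := 0) (j := 1) (P := fun i => (kolmogorovMap f)^[N] x₀ i ≤ 0)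
          (by decide)).2 hcon i
      refine ⟨min (max ((kolmogorovMap f)^[N] x₀ 0) ((kolmogorovMap f)^[N] x₀ 1))
        (min (Q 0 0) (Q 1 1) / 2), lt_min hm (half_pos hqmin),
        (min_le_right _ _).trans_lt (half_lt_self hqmin), fun x hx => ?_⟩
      have hle := (min_le_left _ (min (Q 0 0) (Q 1 1) / 2)).trans (hmin₀ hx)
      rcases le_max_iff.1 hle with hle | hle
      exacts [⟨0, hle⟩, ⟨1, hle⟩]
    have hE := h.mapsTo_awayFromZero hQ hη0 (hmin η hη)
    rw [h.sigmaSet_eq_core hQ hη0 (hmin η hη)] at hSU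
    -- The nested compact images intersect in `Σ`, so one of them already lies in `U`.
    obtain ⟨M, hM⟩ := exists_subset_nhds_of_isCompact
      (V := fun n => (kolmogorovMap f)^[n] '' {x ∈ Icc 0 r | ∃ i, η ≤ x i})
      (image_iterate_antitone hE).directed_ge
      (fun n => h.isCompact_image_iterate (fun x hx => hx.1) (isCompact_awayFromZero r η) n)
      (U := U) fun x hx => hU.mem_nhds (hSU hx)
    refine eventually_atTop.2 ⟨M + N, fun n hn x hx => hM ?_⟩
    obtain ⟨k, rfl⟩ := Nat.exists_eq_add_of_le' hn
    refine image_iterate_antitone hE (Nat.le_add_left M k) ⟨_, ⟨hN x hx, hBη x hx⟩, ?_⟩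
    rw [← Function.iterate_add_apply, add_assoc]

end IsRetrotoneSystem

end PlanarKolmogorov

/-! ### Assembly of the theorem -/

theorem theorem3p2 (f : Plane → Plane) (r : Plane)
    -- `f` is a continuously differentiable map from `C` to the open quadrant
    (hf : ContDiffOn ℝ 1 f quadrant)
    (hpos : ∀ x ∈ quadrant, ∀ i, 0 < f x i)
    (h0 : ∀ i, 1 < f 0 i)
    (hr : StrongLT 0 r)
    (homega : ∀ x ∈ quadrant, (omegaSet (kolmogorovMap f) x).Nonempty ∧
      omegaSet (kolmogorovMap f) x ⊆ Icc 0 r)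
    (hmaps : ∀ x ∈ Icc 0 r, StrongLT (kolmogorovMap f x) r)
    (hrho : ∀ x ∈ Icc 0 r, specRadius (matM f x) < 1)
    (hK : TypeKCompetitiveOn f (Icc 0 r)) :
    ∃ Q : Fin 2 → Plane,
      -- part (a)
      (∀ i, Q i ∈ posHalfAxis i ∧ kolmogorovMap f (Q i) = Q i ∧
        (∀ p ∈ posHalfAxis i, kolmogorovMap f p = p → p = Q i) ∧
        IsSaddle (kolmogorovMap f) (Q i) ∧
        stableManifold (kolmogorovMap f) (Q i) = posHalfAxis i ∧
        unstableManifold (kolmogorovMap f) (Q i) \ {Q i} ⊆ openQuadrant) ∧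
      -- part (b), and the description of the middle part of the attractor from (c)
      (∃ p₀ ∈ openQuadrant, kolmogorovMap f p₀ = p₀ ∧
        ((∀ p ∈ openQuadrant, kolmogorovMap f p = p → p = p₀) →
          GloballyAsymptoticallyStableIn (kolmogorovMap f) openQuadrant p₀ ∧
          sigmaZero (kolmogorovMap f) r = {p₀}) ∧
        (¬ (∀ p ∈ openQuadrant, kolmogorovMap f p = p → p = p₀) →
          ∃ p₁, kolmogorovMap f p₁ = p₁ ∧ StrongLT p₀ p₁ ∧
            (∀ x ∈ openQuadrant,
              (EventuallyConst (fun n => (kolmogorovMap f)^[n] x) atTop ∨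
                EventuallyMonotoneIn StrongLTK (fun n => (kolmogorovMap f)^[n] x) ∨
                EventuallyMonotoneIn (· < ·) (fun n => (kolmogorovMap f)^[n] x)) ∧
              ∃ p ∈ Icc p₀ p₁, kolmogorovMap f p = p ∧
                Tendsto (fun n => (kolmogorovMap f)^[n] x) atTop (𝓝 p)) ∧
            IsMonotoneCurveFromTo StrongLT p₀ p₁ (sigmaZero (kolmogorovMap f) r))) ∧
      -- the rest of part (c)
      IsGlobalAttractorOn (kolmogorovMap f) (quadrant \ {0}) (sigmaSet (kolmogorovMap f) r) ∧
      sigmaSet (kolmogorovMap f) r = sigmaAxis (kolmogorovMap f) r 0 ∪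
        sigmaZero (kolmogorovMap f) r ∪ sigmaAxis (kolmogorovMap f) r 1 ∧
      (∀ i, sigmaAxis (kolmogorovMap f) r i =
          unstableManifold (kolmogorovMap f) (Q i) ∪ {Q i} ∧
        IsMonotoneCurve (· < ·) (sigmaAxis (kolmogorovMap f) r i)) ∧
      ((∀ x ∈ Icc 0 r, 0 < partialDeriv f 0 1 x ∧ 0 < partialDeriv f 1 0 x) →
        ∀ i, IsMonotoneCurve StrongLT (sigmaAxis (kolmogorovMap f) r i)) := by
  have h := isRetrotoneSystem hf hpos h0 hr homega hmaps hrho hK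
  obtain ⟨Q, hQ⟩ := h.exists_axisFamily
  obtain ⟨p₀, p₁, hp⟩ := h.exists_extremalPair hQ
  -- As `p₀` and `p₁` are the least and the greatest interior fixed points, uniqueness means that
  -- they coincide.
  have hunique : (∀ p ∈ openQuadrant, kolmogorovMap f p = p → p = p₀) ↔ p₁ = p₀ := by
    refine ⟨fun H => H p₁ (h.open₁ hQ hp) hp.fixed₁, fun e p hpo hfix => ?_⟩
    have hpX := h.fixed_mem_Icc (fun i => (hpo i).le) hfix
    exact le_antisymm (e ▸ h.le_greatest_of_fixed hp hpX hfix)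
      (h.least_le_of_fixed hQ hp hpX hfix hpo)
  refine ⟨Q, fun i => ?_, ⟨p₀, hp.open₀ hQ, hp.fixed₀, fun H => ?_, fun H => ?_⟩,
    h.isGlobalAttractorOn_sigmaSet hQ, ?_, fun i => ⟨?_, h.isCurve_sigmaAxis hQ hp i,
    h.orderedBy_sigmaAxis hQ i⟩, fun hd i => ⟨h.isCurve_sigmaAxis hQ hp i, ?_⟩⟩
  · obtain ⟨j, hij⟩ := exists_ne_fin_two i
    refine ⟨⟨hQ.pos i, fun k hk => hQ.zero i k hk.symm⟩, hQ.fixed i, fun p hpa hfix => ?_,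
      isSaddle_axis hf hrho hK h hij (hQ.mem i) (hQ.fixed i) (hQ.pos i) (hQ.zero i j hij),
      h.stableManifold_eq hQ i, h.unstableManifold_subset hQ i⟩
    have hpq : p ∈ quadrant := (forall_fin_two_iff hij).2 ⟨hpa.1.le, (hpa.2 j hij.symm).ge⟩
    exact h.eq_of_fixed_axis hQ (h.fixed_mem_Icc hpq hfix) hfix hij hpa.1 (hpa.2 j hij.symm)
  · have e := hunique.1 H
    exact ⟨h.globallyAsymptoticallyStable hQ hp e, h.sigmaZero_eq_singleton hQ hp e⟩
  · have hlt := h.strongLT_of_ne hQ hp fun e => H (hunique.2 e.symm)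
    exact ⟨p₁, hp.fixed₁, hlt, fun x hx => h.forward_description hQ hp hx,
      h.isMonotoneCurveFromTo_sigmaZero hQ hp hlt⟩
  · ext x
    have h1 : ∀ i, sigmaAxis (kolmogorovMap f) r i ⊆ sigmaSet (kolmogorovMap f) r :=
      fun i x hx => hx.1
    have h2 := @h1 0 x
    have h3 := @h1 1 x
    simp only [sigmaZero, mem_union, Set.mem_sdiff]
    tauto
  -- The constant backward orbit already puts `Q i` in its unstable manifold.
  · rw [union_singleton, insert_eq_of_mem]
    · exact ext fun x => (h.mem_unstableManifold_iff hQ).symm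
    · exact (h.mem_unstableManifold_iff hQ).2 (h.axis_mem_sigmaAxis hQ i)
  · obtain ⟨j, hij⟩ := exists_ne_fin_two i
    refine h.orderedBy_strongLT_sigmaAxis hQ hij fun x hx y hy hxy hj hi =>
      kolmogorovMap_apply_lt_of_partialDeriv_pos hf h hij (fun z hz => ?_) hx hy hxy hj hi
    rcases fin_two_cases (show (0 : Fin 2) ≠ 1 by decide) i with rfl | rfl
    · obtain rfl : j = 1 := (fin_two_cases hij j).elim (fun e => absurd e.symm hij) (by omega)
      exact (hd z hz).1
    · obtain rfl : j = 0 := by omega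
      exact (hd z hz).2
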